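/- Let $m\ge 0$ be an integer and let $K,\kappa>0$ be constants. For every $n$ let $X_1=X_1^{(n)},\dots,X_m=X_m^{(n)}$ be independent random $n\times n$ complex matrices, all defined on one probability space (with no assumption on the joint law for different $n$), such that for every $n$ and $j$: - $X_j$ is centered, $\mathbb{E}X_j=0$; - $X_j$ has the convex concentration property with parameters $K,\kappa$ with respect to the Hilbert–Schmidt norm: for every convex $f:M_n(\mathbb{C})\to\mathbb{R}$ that is $1$-Lipschitz for the Hilbert–Schmidt norm there is a median $\mathbb{M}f(X_j)$ of $f(X_j)$ with $\mathbb{P}\left[|f(X_j)-\mathbb{M}f(X_j)|\ge t\right]\le Ke^{-\kappa t^2}$ for all $t>0$; - $X_j$ is almost surely real symmetric, and its entries above the diagonal are independent and have variance $1$. Let $P$ be a noncommutative $*$-polynomial in $m$ variables with complex coefficients, not depending on $n$, and put $$Z_P=\operatorname{tr}P\left(\frac{X_1}{\sqrt n},\dots,\frac{X_m}{\sqrt n}\right).$$ Let $\mathcal{A}$ be a unital $*$-algebra over $\mathbb{C}$, let $\tau:\mathcal{A}\to\mathbb{C}$ be a linear functional with $\tau(1)=1$, and let $a_1,\dots,a_m\in\mathcal{A}$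 be free semicircular elements; that is, each $a_j$ is self-adjoint with $\tau(a_j^k)=\frac1{2\pi}\int_{-2}^{2}x^k\sqrt{4-x^2}\,dx$ for all $k\ge 0$, and, writing $\mathcal{A}_j$ for the unital subalgebra generated by $a_j$, one has $\tau(b_1\cdots b_r)=0$ whenever $r\ge1$, $b_s\in\mathcal{A}_{j_s}$, $\tau(b_s)=0$ for all $s$ and $j_s\ne j_{s+1}$ for $1\le s<r$. Then, almost surely, $$n^{-1}Z_P\to\tau\bigl(P(a_1,\dots,a_m)\bigr)\qquad(n\to\infty).$$ -/

import Mathlib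

open MeasureTheory ProbabilityTheory Filter Topology

namespace NCProb

/-- `M` is a median of the real random variable `Y`. -/
def IsMedian {Ω : Type*} [MeasurableSpace Ω] (P : Measure Ω) (Y : Ω → ℝ) (M : ℝ) : Prop :=
  1 / 2 ≤ P.real {ω | Y ω ≤ M} ∧ 1 / 2 ≤ P.real {ω | M ≤ Y ω}

/-- The (subgaussian) convex concentration property, with parameters `K` and `κ`, of a random
vector `X` in a real normed space `V`: every convex `1`-Lipschitz function `f` of `X` is
concentrated about a median `M` of `f(X)`. -/
def ConvexConcentration {Ω V : Type*} [MeasurableSpace Ω] [NormedAddCommGroup V] [NormedSpace ℝ V]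
    (P : Measure Ω) (X : Ω → V) (K κ : ℝ) : Prop :=
  ∀ f : V → ℝ, ConvexOn ℝ Set.univ f → LipschitzWith 1 f →
    ∃ M : ℝ, IsMedian P (fun ω => f (X ω)) M ∧
      ∀ t : ℝ, 0 < t → P.real {ω | t ≤ |f (X ω) - M|} ≤ K * Real.exp (-κ * t ^ 2)

section HilbertSchmidt

attribute [local instance] Matrix.frobeniusNormedAddCommGroup Matrix.frobeniusNormedSpace

/-- The convex concentration property of a random complex `n × n` matrix, with respect to the
Hilbert-Schmidt (Frobenius) norm. -/
def MatrixConvexConcentration {Ω : Type*} [MeasurableSpace Ω] (P : Measure Ω) {n : ℕ}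
    (X : Ω → Matrix (Fin n) (Fin n) ℂ) (K κ : ℝ) : Prop :=
  ConvexConcentration P X K κ

end HilbertSchmidt

/-- Noncommutative `*`-polynomials in `m` variables with complex coefficients: the free algebra on
the letters `Sum.inl j` (the variable `x_j`) and `Sum.inr j` (its formal adjoint `x_j^*`). -/
abbrev StarPoly (m : ℕ) : Type := FreeAlgebra ℂ (Fin m ⊕ Fin m)

/-- Evaluation `Q(a_1, …, a_m)` of a noncommutative `*`-polynomial in a `*`-algebra. -/
noncomputable def StarPoly.eval {m : ℕ} {A : Type*} [Ring A] [StarRing A] [Algebra ℂ A]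
    (a : Fin m → A) (Q : StarPoly m) : A :=
  FreeAlgebra.lift ℂ (Sum.elim a fun j => star (a j)) Q

/-- Freeness of a family of unital subalgebras with respect to a linear functional `τ`: a
nonempty product of `τ`-centered elements, any two neighbouring factors of which are taken from
subalgebras with different indices, is `τ`-centered. -/
def FreeSubalgebras {ι A : Type*} [Ring A] [Algebra ℂ A] (τ : A →ₗ[ℂ] ℂ)
    (S : ι → Subalgebra ℂ A) : Prop :=
  ∀ l : List (ι × A), l ≠ [] → l.IsChain (fun p q => p.1 ≠ q.1) →
    (∀ p ∈ l, p.2 ∈ S p.1 ∧ τ p.2 = 0) → τ (l.map Prod.snd).prod = 0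

/-- A (standard) semicircular element: self-adjoint, with the moments of the semicircle law of
mean `0` and variance `1`, whose density is `√(4 - x²) / (2π)` on `[-2, 2]`. -/
def IsSemicircular {A : Type*} [Ring A] [StarRing A] [Algebra ℂ A] (τ : A →ₗ[ℂ] ℂ) (a : A) :
    Prop :=
  IsSelfAdjoint a ∧ ∀ k : ℕ, τ (a ^ k) =
    ((∫ x in (-2 : ℝ)..2, x ^ k * (Real.sqrt (4 - x ^ 2) / (2 * Real.pi)) : ℝ) : ℂ)

/-- `a_1, …, a_m` are free semicircular elements: each is semicircular, and the unital (`*`-)algebras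
that they generate are free. As `a_j` is self-adjoint, `Algebra.adjoin ℂ {a_j}` is that algebra. -/
def IsFreeSemicircularFamily {m : ℕ} {A : Type*} [Ring A] [StarRing A] [Algebra ℂ A]
    (τ : A →ₗ[ℂ] ℂ) (a : Fin m → A) : Prop :=
  (∀ j, IsSemicircular τ (a j)) ∧ FreeSubalgebras τ fun j => Algebra.adjoin ℂ {a j}

/-- `Z_Q = tr Q(X_1 / √n, …, X_m / √n)`, with the unnormalized trace. -/
noncomputable def traceStat {m n : ℕ} (Q : StarPoly m) (X : Fin m → Matrix (Fin n) (Fin n) ℂ) :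
    ℂ :=
  (StarPoly.eval (fun j => ((Real.sqrt n : ℂ))⁻¹ • X j) Q).trace

end NCProb

set_option linter.unusedSectionVars false

namespace NCProb

/-! ### Coloured walks on a complete graph with loops -/

/-! Both sides are linear in the polynomial and all variables are self-adjoint, so it suffices to
treat words in unstarred letters. Convex concentration enters only through single entries: the real
part of an entry is convex and 1-Lipschitz, so centering and the subgaussian tails bound all its
moments uniformly in `n` (`moments_of_tail`). From there on the argument is a moment method.

Replace the diagonals by zero for the moment. The trace of a word of length `k` is a sum over closed
walks whose steps are coloured by the letters. A walk contributes only if each of its edges is used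
at least twice, and a connected graph has at most one vertex more than edges; hence few vertices are
available and sums over degenerate walks are small. This gives two estimates. Pairing the first step
with the step that retraces it yields an approximate Schwinger-Dyson equation
(`IsEdgeMoment.abs_traceMoment_cons_sub_le`), with error of order `n^(-1/2)` after normalization.
Two closed walks are correlated only if they share an edge, which costs enough vertices to make the
covariance of normalized traces `O(n^(-3/2))` (`IsEdgeMoment.abs_traceMoment₂_sub_le`). The first
estimate, with the second to factorize products, determines the limit of the means by induction on
the length. The second with equal words is a summable variance bound, so convergence is almost sure
whatever the joint law for different `n` (`ae_tendsto_normTrace`).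

The limit is the vacuum coefficient `fockCoeff w []` of a word in the field operators on the free
Fock space, which satisfies the exact Schwinger-Dyson recursion. It equals the moment of free
semicircular elements because products of Chebyshev polynomials in the `a_j` are centered by
freeness and obey the three-term recursion of the field operators
(`IsFreeSemicircularFamily.apply_prod`).

The diagonal entries need not be independent of anything, so they are restored by operator norms.
Traces of high powers bound the off-diagonal part by an arbitrarily small power of `n`, while the
normalized diagonal is eventually at most `n^(-1/4)`; a telescoping product then shows that the
diagonal does not affect the limit (`tendsto_trace_prod_sub`). -/

/-- Coloured edges are compared through their decidable equality. -/
instance colouredEdgeBEq {ι α : Type*} [DecidableEq ι] [DecidableEq α] : BEq (ι × Sym2 α) :=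
  instBEqOfDecidableEq

section Walk

variable {ι α : Type*}

/-- The coloured unoriented edge traversed by a step `(colour, source, target)`. -/
def stepEdge (d : ι × α × α) : ι × Sym2 α := (d.1, s(d.2.1, d.2.2))

/-- The list of steps `L` is a walk from `p` to `q`. -/
def IsWalk : α → List (ι × α × α) → α → Prop
  | p, [], q => p = q
  | p, d :: L, q => d.2.1 = p ∧ IsWalk d.2.2 L q

theorem IsWalk.exists_of_append {p q : α} {L L' : List (ι × α × α)} (h : IsWalk p (L ++ L') q) :
    ∃ r, IsWalk p L r ∧ IsWalk r L' q := by
  induction L generalizing p with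
  | nil => exact ⟨p, rfl, h⟩
  | cons d L ih =>
    obtain ⟨r, h1, h2⟩ := ih h.2
    exact ⟨r, ⟨h.1, h1⟩, h2⟩

variable [DecidableEq ι] [DecidableEq α]

/-- The vertices visited by a walk starting at `p`. -/
def walkVerts (p : α) (L : List (ι × α × α)) : Finset α :=
  insert p (L.map fun d => d.2.2).toFinset

/-- The coloured edges used by a walk. -/
def walkEdges (L : List (ι × α × α)) : Finset (ι × Sym2 α) := (L.map stepEdge).toFinset

theorem mem_walkVerts_self (p : α) (L : List (ι × α × α)) : p ∈ walkVerts p L :=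
  Finset.mem_insert_self _ _

theorem walkVerts_nil (p : α) : walkVerts p ([] : List (ι × α × α)) = {p} := by
  simp [walkVerts]

theorem walkVerts_cons (p : α) (d : ι × α × α) (L : List (ι × α × α)) :
    walkVerts p (d :: L) = insert p (walkVerts d.2.2 L) := by
  simp [walkVerts]

theorem walkEdges_cons (d : ι × α × α) (L : List (ι × α × α)) :
    walkEdges (d :: L) = insert (stepEdge d) (walkEdges L) := by
  simp [walkEdges]

theorem walkEdges_append (L L' : List (ι × α × α)) :
    walkEdges (L ++ L') = walkEdges L ∪ walkEdges L' := by
  simp [walkEdges, List.toFinset_append]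

theorem IsWalk.end_mem {p q : α} {L : List (ι × α × α)} (h : IsWalk p L q) :
    q ∈ walkVerts p L := by
  induction L generalizing p with
  | nil => obtain rfl : p = q := h; exact mem_walkVerts_self _ _
  | cons d L ih => rw [walkVerts_cons]; exact Finset.mem_insert_of_mem (ih h.2)

theorem IsWalk.walkVerts_append {p r : α} {L L' : List (ι × α × α)} (h : IsWalk p L r) :
    walkVerts p (L ++ L') = walkVerts p L ∪ walkVerts r L' := by
  induction L generalizing p with
  | nil =>
    obtain rfl : p = r := h
    rw [walkVerts_nil, List.nil_append, ← Finset.insert_eq,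
      Finset.insert_eq_of_mem (mem_walkVerts_self _ _)]
  | cons d L ih => rw [List.cons_append, walkVerts_cons, ih h.2, walkVerts_cons,
      Finset.insert_union]

theorem IsWalk.mem_verts_of_mem_edges {p q : α} {L : List (ι × α × α)} (h : IsWalk p L q)
    {e : ι × Sym2 α} (he : e ∈ walkEdges L) {x : α} (hx : x ∈ e.2) : x ∈ walkVerts p L := by
  induction L generalizing p with
  | nil => simp [walkEdges] at he
  | cons d L ih =>
    rw [walkVerts_cons]
    rw [walkEdges_cons, Finset.mem_insert] at he
    rcases he with rfl | he
    · simp only [stepEdge, Sym2.mem_iff] at hx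
      rcases hx with rfl | rfl
      · rw [h.1]; exact Finset.mem_insert_self _ _
      · exact Finset.mem_insert_of_mem (mem_walkVerts_self _ _)
    · exact Finset.mem_insert_of_mem (ih h.2 he)

/-- Attaching a walk to a set of vertices that it meets creates at most as many new vertices as
new edges. -/
theorem IsWalk.card_union_verts_add_le {p q : α} {L : List (ι × α × α)} (h : IsWalk p L q)
    {V : Finset α} {E : Finset (ι × Sym2 α)} (hE : ∀ e ∈ E, ∀ x ∈ e.2, x ∈ V)
    (hV : ∃ x ∈ walkVerts p L, x ∈ V) :
    (V ∪ walkVerts p L).card + E.card ≤ V.card + (E ∪ walkEdges L).card := by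
  induction L generalizing p V E with
  | nil =>
    obtain ⟨x, hx, hxV⟩ := hV
    rw [walkVerts_nil, Finset.mem_singleton] at hx
    subst hx
    rw [walkVerts_nil, Finset.union_eq_left.2 (by simpa using hxV)]
    simp [walkEdges]
  | cons d L ih =>
    obtain ⟨j, p', v⟩ := d
    obtain ⟨rfl, hL⟩ : p' = p ∧ IsWalk v L q := h
    rw [walkVerts_cons, walkEdges_cons]
    dsimp only
    -- If the tail meets `V`, attach it alone; a start that is still missing then makes the first
    -- edge new as well. Otherwise `V` is met only at the start, so the first edge and its target
    -- are both new and are added to `E` and `V` before the tail is attached.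
    by_cases hm : ∃ x ∈ walkVerts v L, x ∈ V
    · have key := ih hL hE hm
      by_cases hp : p' ∈ V ∪ walkVerts v L
      · have h1 : V ∪ insert p' (walkVerts v L) = V ∪ walkVerts v L := by
          rw [Finset.union_insert, Finset.insert_eq_of_mem hp]
        rw [h1]
        refine key.trans ?_
        gcongr
        exact Finset.subset_insert _ _
      · have he : stepEdge (j, p', v) ∉ E ∪ walkEdges L := by
          intro he
          have hpm : p' ∈ (stepEdge (j, p', v)).2 := by simp [stepEdge]
          rcases Finset.mem_union.1 he with he | he
          · exact hp (Finset.mem_union_left _ (hE _ he _ hpm))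
          · exact hp (Finset.mem_union_right _ (hL.mem_verts_of_mem_edges he hpm))
        rw [Finset.union_insert, Finset.union_insert, Finset.card_insert_of_notMem hp,
          Finset.card_insert_of_notMem he]
        omega
    · have hpV : p' ∈ V := by
        obtain ⟨x, hx, hxV⟩ := hV
        rw [walkVerts_cons, Finset.mem_insert] at hx
        rcases hx with rfl | hx
        · exact hxV
        · exact absurd ⟨x, hx, hxV⟩ hm
      have hv : v ∉ V := fun hv => hm ⟨v, mem_walkVerts_self _ _, hv⟩
      have he : stepEdge (j, p', v) ∉ E := fun he => hv (hE _ he v (by simp [stepEdge]))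
      have key := ih (V := insert v V) (E := insert (stepEdge (j, p', v)) E) hL (by
        intro e he' x hx
        rcases Finset.mem_insert.1 he' with rfl | he'
        · simp only [stepEdge, Sym2.mem_iff] at hx
          rcases hx with rfl | rfl
          · exact Finset.mem_insert_of_mem hpV
          · exact Finset.mem_insert_self _ _
        · exact Finset.mem_insert_of_mem (hE _ he' x hx))
        ⟨v, mem_walkVerts_self _ _, Finset.mem_insert_self _ _⟩
      rw [Finset.card_insert_of_notMem hv, Finset.card_insert_of_notMem he] at key
      have h1 : insert v V ∪ walkVerts v L = V ∪ insert p' (walkVerts v L) := by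
        rw [Finset.insert_union, Finset.insert_eq_of_mem
          (Finset.mem_union_right _ (mem_walkVerts_self _ _)), Finset.union_insert,
          Finset.insert_eq_of_mem (Finset.mem_union_left _ hpV)]
      have h2 : insert (stepEdge (j, p', v)) E ∪ walkEdges L
          = E ∪ insert (stepEdge (j, p', v)) (walkEdges L) := by
        rw [Finset.insert_union, Finset.union_insert]
      rw [h1, h2] at key
      omega

theorem IsWalk.card_verts_le {p q : α} {L : List (ι × α × α)} (h : IsWalk p L q) :
    (walkVerts p L).card ≤ (walkEdges L).card + 1 := by
  have := h.card_union_verts_add_le (V := {p}) (E := ∅) (by simp)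
    ⟨p, mem_walkVerts_self _ _, by simp⟩
  rw [Finset.union_eq_right.2 (by simpa using mem_walkVerts_self p L)] at this
  simp only [Finset.card_empty, Finset.card_singleton, Finset.empty_union] at this
  omega

/-- This keeps the exact vertex and edge counts of the first walk, so that a saving in that walk
carries over to the union. -/
theorem IsWalk.card_union_le {p q p' q' : α} {L L' : List (ι × α × α)} (h : IsWalk p L q)
    (h' : IsWalk p' L' q') (hx : ∃ x ∈ walkVerts p' L', x ∈ walkVerts p L) :
    (walkVerts p L ∪ walkVerts p' L').card + (walkEdges L).card ≤
      (walkVerts p L).card + (walkEdges L ∪ walkEdges L').card :=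
  h'.card_union_verts_add_le (fun _ he _ hx => h.mem_verts_of_mem_edges he hx) hx

theorem IsWalk.card_union_le_succ {p q p' q' : α} {L L' : List (ι × α × α)} (h : IsWalk p L q)
    (h' : IsWalk p' L' q') (hx : ∃ x ∈ walkVerts p' L', x ∈ walkVerts p L) :
    (walkVerts p L ∪ walkVerts p' L').card ≤ (walkEdges L ∪ walkEdges L').card + 1 := by
  have h1 := h.card_union_le h' hx
  have h2 := h.card_verts_le
  omega

/-- A closed walk with an edge that is used only once visits at most as many vertices as edges. -/
theorem IsWalk.card_verts_le_of_count_eq_one {p : α} {L : List (ι × α × α)} (h : IsWalk p L p)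
    {e : ι × Sym2 α} (he : (L.map stepEdge).count e = 1) :
    (walkVerts p L).card ≤ (walkEdges L).card := by
  have hmem : e ∈ L.map stepEdge := List.count_pos_iff.1 (by omega)
  obtain ⟨d, hd, rfl⟩ := List.mem_map.1 hmem
  obtain ⟨L1, L2, rfl⟩ := List.append_of_mem hd
  obtain ⟨x, h1, h2⟩ := h.exists_of_append
  obtain ⟨hx, h2⟩ := h2
  have hc : stepEdge d ∉ walkEdges L1 ∪ walkEdges L2 := by
    simp only [List.map_append, List.map_cons, List.count_append, List.count_cons_self] at he
    simp only [walkEdges, Finset.mem_union, List.mem_toFinset, ← List.count_pos_iff]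
    omega
  -- The walk is closed, so `L2` ends where `L1` begins: deleting the edge leaves a connected graph
  -- on the same vertices, with one edge fewer.
  have key := h2.card_union_le_succ h1 ⟨p, mem_walkVerts_self _ _, h2.end_mem⟩
  have hV : walkVerts p (L1 ++ d :: L2) = walkVerts d.2.2 L2 ∪ walkVerts p L1 := by
    rw [h1.walkVerts_append, walkVerts_cons, Finset.union_insert,
      Finset.insert_eq_of_mem (Finset.mem_union_left _ h1.end_mem), Finset.union_comm]
  have hE : walkEdges (L1 ++ d :: L2) = insert (stepEdge d) (walkEdges L1 ∪ walkEdges L2) := by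
    rw [walkEdges_append, walkEdges_cons, Finset.union_insert]
  rw [hV, hE, Finset.card_insert_of_notMem hc, Finset.union_comm (walkEdges L1)]
  exact key

end Walk

/-! ### Mixed moments of independent variables -/

theorem two_mul_card_toFinset_le {C : Type*} [DecidableEq C] {L : List C}
    (h : ∀ c ∈ L, 2 ≤ L.count c) : 2 * L.toFinset.card ≤ L.length := by
  rw [← List.sum_toFinset_count_eq_length, mul_comm, ← smul_eq_mul, ← Finset.sum_const]
  exact Finset.sum_le_sum fun c hc => h c (List.mem_toFinset.1 hc)

theorem two_mul_card_toFinset_lt {C : Type*} [DecidableEq C] {L : List C}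
    (h : ∀ c ∈ L, 2 ≤ L.count c) {e : C} (he : 3 ≤ L.count e) :
    2 * L.toFinset.card < L.length := by
  rw [← List.sum_toFinset_count_eq_length, mul_comm, ← smul_eq_mul, ← Finset.sum_const]
  exact Finset.sum_lt_sum (fun c hc => h c (List.mem_toFinset.1 hc))
    ⟨e, List.mem_toFinset.2 (List.count_pos_iff.1 (by omega)), by omega⟩

section Moments

variable {C : Type*} [Fintype C] [DecidableEq C]

/-- The mixed moment of the product of the independent variables listed in `L`, the variable `c`
having `k`-th moment `μ c k`. -/
def mixedMoment (μ : C → ℕ → ℝ) (L : List C) : ℝ := ∏ c, μ c (L.count c)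

variable {μ : C → ℕ → ℝ}

theorem mixedMoment_nil (h0 : ∀ c, μ c 0 = 1) : mixedMoment μ [] = 1 := by
  simp [mixedMoment, h0]

theorem mixedMoment_perm {L L' : List C} (h : L.Perm L') : mixedMoment μ L = mixedMoment μ L' :=
  Finset.prod_congr rfl fun c _ => by rw [h.count_eq]

theorem mixedMoment_eq_zero (h1 : ∀ c, μ c 1 = 0) {L : List C} {c : C} (hc : L.count c = 1) :
    mixedMoment μ L = 0 :=
  Finset.prod_eq_zero (Finset.mem_univ c) (by rw [hc, h1])

theorem two_le_count_of_mixedMoment_ne_zero (h1 : ∀ c, μ c 1 = 0) {L : List C}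
    (hL : mixedMoment μ L ≠ 0) : ∀ c ∈ L, 2 ≤ L.count c := by
  intro c hc
  have h0 : 0 < L.count c := List.count_pos_iff.2 hc
  have : L.count c ≠ 1 := fun h => hL (mixedMoment_eq_zero h1 h)
  omega

theorem mixedMoment_append (h0 : ∀ c, μ c 0 = 1) {L L' : List C} (h : ∀ c ∈ L, c ∉ L') :
    mixedMoment μ (L ++ L') = mixedMoment μ L * mixedMoment μ L' := by
  rw [mixedMoment, mixedMoment, mixedMoment, ← Finset.prod_mul_distrib]
  refine Finset.prod_congr rfl fun c _ => ?_
  rw [List.count_append]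
  by_cases hc : c ∈ L
  · rw [List.count_eq_zero_of_not_mem (h c hc), h0, add_zero, mul_one]
  · rw [List.count_eq_zero_of_not_mem hc, h0, zero_add, one_mul]

theorem mixedMoment_cons_of_count_eq_one (h0 : ∀ c, μ c 0 = 1) {e : C} (h2 : μ e 2 = 1)
    {L : List C} (he : L.count e = 1) : mixedMoment μ (e :: L) = mixedMoment μ (L.erase e) := by
  refine Finset.prod_congr rfl fun c _ => ?_
  by_cases hc : c = e
  · subst hc
    rw [List.count_cons_self, he, List.count_erase_self, he, h2, h0]
  · rw [List.count_cons_of_ne (Ne.symm hc), List.count_erase_of_ne hc]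

/-- Variables outside `L` contribute a factor 1, and at most `L.length` variables occur in `L`. -/
theorem abs_mixedMoment_le {B : ℕ → ℝ} (hB : Monotone B) (hB1 : ∀ k, 1 ≤ B k)
    (h0 : ∀ c, μ c 0 = 1) (hμ : ∀ c k, |μ c k| ≤ B k) (L : List C) :
    |mixedMoment μ L| ≤ B L.length ^ L.length := by
  rw [mixedMoment, Finset.abs_prod]
  calc ∏ c, |μ c (L.count c)| ≤ ∏ c, (if c ∈ L.toFinset then B L.length else 1) := by
        refine Finset.prod_le_prod (fun _ _ => abs_nonneg _) fun c _ => ?_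
        split_ifs with hc
        · exact (hμ _ _).trans (hB List.count_le_length)
        · rw [List.count_eq_zero_of_not_mem (by simpa using hc), h0, abs_one]
    _ = B L.length ^ L.toFinset.card := by
        rw [Finset.prod_ite_mem, Finset.univ_inter, Finset.prod_const]
    _ ≤ _ := pow_le_pow_right₀ (hB1 _) (List.toFinset_card_le L)

end Moments

/-! ### Vertex counts of walks with nonzero mixed moments -/

section WalkMoments

variable {ι α : Type*} [Fintype ι] [DecidableEq ι] [Fintype α] [DecidableEq α]
  {μ : ι × Sym2 α → ℕ → ℝ}

/-- If a walk visits many vertices, then its first edge has to be paired with exactly one other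
edge. -/
theorem IsWalk.mixedMoment_cons (h0 : ∀ c, μ c 0 = 1) (h1 : ∀ c, μ c 1 = 0)
    {j : ι} {p v q : α} (h2 : μ (j, s(p, v)) 2 = 1)
    {L : List (ι × α × α)} (h : IsWalk v L q)
    (hbig : L.length + 2 < 2 * (walkVerts p ((j, p, v) :: L)).card) :
    mixedMoment μ ((j, s(p, v)) :: L.map stepEdge) =
      (L.map stepEdge).count (j, s(p, v)) *
        mixedMoment μ ((L.map stepEdge).erase (j, s(p, v))) := by
  set e : ι × Sym2 α := (j, s(p, v)) with he
  have hw : IsWalk p ((j, p, v) :: L) q := ⟨rfl, h⟩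
  have hV := hw.card_verts_le
  have hE : walkEdges ((j, p, v) :: L) = (e :: L.map stepEdge).toFinset := by
    simp [walkEdges, stepEdge, he]
  -- An unpaired first edge kills both sides; a pairing with exactly one later edge contributes the
  -- variance 1; with two or more later occurrences, a nonzero moment on either side would leave too
  -- few edges for the vertices in `hbig`.
  rcases Nat.lt_trichotomy ((L.map stepEdge).count e) 1 with hc | hc | hc
  · have hc : (L.map stepEdge).count e = 0 := by omega
    rw [mixedMoment_eq_zero h1 (c := e) (by rw [List.count_cons_self, hc]), hc]
    simp
  · rw [mixedMoment_cons_of_count_eq_one h0 h2 hc, hc]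
    simp
  · have z1 : mixedMoment μ (e :: L.map stepEdge) = 0 := by
      by_contra hne
      have := two_mul_card_toFinset_lt (two_le_count_of_mixedMoment_ne_zero h1 hne) (e := e)
        (by rw [List.count_cons_self]; omega)
      rw [← hE] at this
      simp only [List.length_cons, List.length_map] at this
      omega
    have z2 : mixedMoment μ ((L.map stepEdge).erase e) = 0 := by
      by_contra hne
      have := two_mul_card_toFinset_le (two_le_count_of_mixedMoment_ne_zero h1 hne)
      have hmem : e ∈ L.map stepEdge := List.count_pos_iff.1 (by omega)
      have hmem' : e ∈ (L.map stepEdge).erase e :=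
        List.count_pos_iff.1 (by rw [List.count_erase_self]; omega)
      have hp : (e :: L.map stepEdge).toFinset = ((L.map stepEdge).erase e).toFinset := by
        have := List.toFinset_eq_of_perm _ _ (List.perm_cons_erase hmem)
        rw [List.toFinset_cons, this, List.toFinset_cons, Finset.insert_eq_of_mem
          (Finset.mem_insert_self _ _), Finset.insert_eq_of_mem (List.mem_toFinset.2 hmem')]
      rw [← hp, ← hE, List.length_erase_of_mem hmem, List.length_map] at this
      have : 0 < L.length := by
        have := List.length_pos_of_mem hmem
        simpa using this
      omega
    rw [z1, z2, mul_zero]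

/-- The common starting point makes the union connected, and each edge is used at least twice. -/
theorem IsWalk.two_mul_card_union_le (h1 : ∀ c, μ c 1 = 0) {v x q : α}
    {L L' : List (ι × α × α)} (h : IsWalk v L x) (h' : IsWalk v L' q)
    (hne : mixedMoment μ (L.map stepEdge ++ L'.map stepEdge) ≠ 0) :
    2 * (walkVerts v L ∪ walkVerts v L').card ≤ L.length + L'.length + 2 := by
  have hV := h.card_union_le_succ h' ⟨v, mem_walkVerts_self _ _, mem_walkVerts_self _ _⟩
  have := two_mul_card_toFinset_le (two_le_count_of_mixedMoment_ne_zero h1 hne)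
  rw [List.toFinset_append] at this
  simp only [List.length_append, List.length_map] at this
  simp only [walkEdges] at hV
  omega

/-- Failure of factorization forces a shared edge, hence a connected union, and every edge is used
at least twice in total: an edge used once would make both moments vanish. This alone gives `+ 2`;
the improvement to `+ 1` is what makes the covariance small. -/
theorem IsWalk.two_mul_card_union_le_of_ne (h0 : ∀ c, μ c 0 = 1) (h1 : ∀ c, μ c 1 = 0) {p q : α}
    {L L' : List (ι × α × α)} (h : IsWalk p L p) (h' : IsWalk q L' q)
    (hne : mixedMoment μ (L.map stepEdge ++ L'.map stepEdge) ≠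
      mixedMoment μ (L.map stepEdge) * mixedMoment μ (L'.map stepEdge)) :
    2 * (walkVerts p L ∪ walkVerts q L').card ≤ L.length + L'.length + 1 := by
  obtain ⟨e, heL, heL'⟩ : ∃ e ∈ L.map stepEdge, e ∈ L'.map stepEdge := by
    by_contra! hc
    exact hne (mixedMoment_append h0 hc)
  have hshare : ∃ x ∈ walkVerts q L', x ∈ walkVerts p L := by
    obtain ⟨x, hx⟩ : ∃ x, x ∈ e.2 := by
      induction e.2 with
      | h a b => exact ⟨a, Sym2.mem_mk_left a b⟩
    exact ⟨x, h'.mem_verts_of_mem_edges (List.mem_toFinset.2 heL') hx,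
      h.mem_verts_of_mem_edges (List.mem_toFinset.2 heL) hx⟩
  have hall : ∀ c ∈ L.map stepEdge ++ L'.map stepEdge,
      2 ≤ (L.map stepEdge ++ L'.map stepEdge).count c := by
    intro c hc
    by_contra hlt
    have hpos := List.count_pos_iff.2 hc
    have hone : (L.map stepEdge ++ L'.map stepEdge).count c = 1 := by omega
    refine hne ?_
    rw [mixedMoment_eq_zero h1 hone]
    rw [List.count_append] at hone
    rcases Nat.eq_zero_or_pos ((L.map stepEdge).count c) with hz | hz
    · rw [mixedMoment_eq_zero h1 (L := L'.map stepEdge) (c := c) (by omega), mul_zero]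
    · rw [mixedMoment_eq_zero h1 (L := L.map stepEdge) (c := c) (by omega), zero_mul]
  have hlen : (L.map stepEdge ++ L'.map stepEdge).length = L.length + L'.length := by simp
  have hEU : (L.map stepEdge ++ L'.map stepEdge).toFinset = walkEdges L ∪ walkEdges L' := by
    rw [List.toFinset_append]; rfl
  have hU := h.card_union_le h' hshare
  -- An edge used once by the closed walk `L` saves a vertex. Otherwise the shared edge is used
  -- twice by `L` and once more by `L'`, so its multiplicity is at least three and the number of
  -- edges drops.
  by_cases hsing : ∃ c, (L.map stepEdge).count c = 1
  · obtain ⟨c, hc⟩ := hsing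
    have hV := h.card_verts_le_of_count_eq_one hc
    have := two_mul_card_toFinset_le hall
    rw [hEU, hlen] at this
    omega
  · have he2 : 2 ≤ (L.map stepEdge).count e := by
      have := List.count_pos_iff.2 heL
      have : (L.map stepEdge).count e ≠ 1 := fun h => hsing ⟨e, h⟩
      omega
    have := two_mul_card_toFinset_lt hall (e := e) (by
      have := List.count_pos_iff.2 heL'
      rw [List.count_append]; omega)
    rw [hEU, hlen] at this
    have hV := h.card_verts_le
    omega

end WalkMoments

/-! ### Sums over the decompositions of a list -/

section SplitSum

/-- The sum of `G u d v` over all decompositions `L = u ++ d :: v`. -/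
def splitSum {β M : Type*} [AddCommMonoid M] : List β → (List β → β → List β → M) → M
  | [], _ => 0
  | d :: L, G => G [] d L + splitSum L fun u c v => G (d :: u) c v

variable {β γ M : Type*} [AddCommMonoid M]

theorem splitSum_congr {L : List β} {G H : List β → β → List β → M}
    (h : ∀ u d v, L = u ++ d :: v → G u d v = H u d v) : splitSum L G = splitSum L H := by
  induction L generalizing G H with
  | nil => rfl
  | cons d L ih =>
    rw [splitSum, splitSum, h [] d L rfl]
    congr 1
    exact ih fun u c v hL => h (d :: u) c v (by rw [hL]; rfl)

theorem splitSum_zero {β : Type*} (L : List β) : splitSum L (fun _ _ _ => (0 : ℝ)) = 0 := by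
  induction L with
  | nil => rfl
  | cons d L ih => rw [splitSum, ih, zero_add]

theorem sum_splitSum (S : Finset γ) (L : List β) (G : γ → List β → β → List β → M) :
    ∑ s ∈ S, splitSum L (G s) = splitSum L fun u d v => ∑ s ∈ S, G s u d v := by
  induction L generalizing G with
  | nil => simp [splitSum]
  | cons d L ih => simp only [splitSum, Finset.sum_add_distrib, ih]

theorem splitSum_mul_left (a : ℝ) (L : List β) (G : List β → β → List β → ℝ) :
    a * splitSum L G = splitSum L fun u d v => a * G u d v := by
  induction L generalizing G with
  | nil => simp [splitSum]
  | cons d L ih => simp only [splitSum, mul_add, ih]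

theorem abs_splitSum_sub_le {L : List β} {G H : List β → β → List β → ℝ} {K : ℝ}
    (h : ∀ u d v, L = u ++ d :: v → |G u d v - H u d v| ≤ K) :
    |splitSum L G - splitSum L H| ≤ L.length * K := by
  induction L generalizing G H with
  | nil => simp [splitSum]
  | cons d L ih =>
    simp only [splitSum, List.length_cons, Nat.cast_add, Nat.cast_one]
    have h1 := h [] d L rfl
    have h2 := ih (G := fun u c v => G (d :: u) c v) (H := fun u c v => H (d :: u) c v)
      fun u c v hL => h (d :: u) c v (by rw [hL]; rfl)
    calc _ = |(G [] d L - H [] d L) + (splitSum L (fun u c v => G (d :: u) c v)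
          - splitSum L (fun u c v => H (d :: u) c v))| := by congr 1; ring
      _ ≤ _ := abs_add_le _ _
      _ ≤ _ := by linarith

theorem tendsto_splitSum {L : List β} {σ : Type*} {l : Filter σ}
    {G : σ → List β → β → List β → ℝ} {H : List β → β → List β → ℝ}
    (h : ∀ u d v, L = u ++ d :: v → Tendsto (fun s => G s u d v) l (𝓝 (H u d v))) :
    Tendsto (fun s => splitSum L (G s)) l (𝓝 (splitSum L H)) := by
  induction L generalizing G H with
  | nil => exact tendsto_const_nhds
  | cons d L ih =>
    exact (h [] d L rfl).add (ih (G := fun s u c v => G s (d :: u) c v)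
      fun u c v hL => h (d :: u) c v (by rw [hL]; rfl))

/-- All occurrences of `e` contribute equally, since `F` does not depend on the order. This turns
the multiplicity in `IsWalk.mixedMoment_cons` into a sum over the later letters that may be paired
with the first. -/
theorem splitSum_erase [DecidableEq γ] (f : β → γ) (e : γ) {F : List γ → ℝ}
    (hF : ∀ l l', l.Perm l' → F l = F l') (L : List β) :
    splitSum L (fun u d v => if f d = e then F (u.map f ++ v.map f) else 0) =
      (L.map f).count e * F ((L.map f).erase e) := by
  induction L generalizing F with
  | nil => simp [splitSum]
  | cons d L ih =>
    rw [splitSum]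
    have := ih (F := fun l => F (f d :: l)) fun l l' h => hF _ _ (h.cons _)
    simp only [List.map_cons, List.cons_append, List.map_nil, List.nil_append] at this ⊢
    rw [this]
    by_cases hd : f d = e
    · subst hd
      rw [if_pos rfl, List.count_cons_self, List.erase_cons_head]
      rcases Nat.eq_zero_or_pos ((L.map f).count (f d)) with h | h
      · rw [h]; simp
      · rw [hF _ _ (List.perm_cons_erase (List.count_pos_iff.1 h)).symm]
        push_cast; ring
    · rw [if_neg hd, List.count_cons_of_ne hd, List.erase_cons_tail (by simpa using hd), zero_add]

end SplitSum

/-! ### Sums over walks -/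

section Walks

variable {ι α : Type*} [DecidableEq ι] [DecidableEq α] [Fintype α]

/-- The walks from `p` to `q` with prescribed sequence of colours. -/
def walks : List ι → α → α → Finset (List (ι × α × α))
  | [], p, q => if p = q then {[]} else ∅
  | j :: w, p, q => Finset.univ.biUnion fun v =>
      (walks w v q).map ⟨List.cons (j, p, v), List.cons_injective⟩

theorem sum_walks_nil {M : Type*} [AddCommMonoid M] (p q : α) (F : List (ι × α × α) → M) :
    ∑ L ∈ walks [] p q, F L = if p = q then F [] else 0 := by
  rw [walks]; split_ifs <;> simp

theorem sum_walks_cons {M : Type*} [AddCommMonoid M] (j : ι) (w : List ι) (p q : α)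
    (F : List (ι × α × α) → M) :
    ∑ L ∈ walks (j :: w) p q, F L = ∑ v, ∑ L ∈ walks w v q, F ((j, p, v) :: L) := by
  rw [walks, Finset.sum_biUnion]
  · exact Finset.sum_congr rfl fun v _ => Finset.sum_map _ _ _
  · intro v _ v' _ hv
    rw [Function.onFun, Finset.disjoint_left]
    intro L hL hL'
    obtain ⟨l, -, rfl⟩ := Finset.mem_map.1 hL
    obtain ⟨l', -, h⟩ := Finset.mem_map.1 hL'
    simp only [Function.Embedding.coeFn_mk, List.cons.injEq, Prod.mk.injEq, true_and] at h
    exact hv h.1.symm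

theorem mem_walks_cons {j : ι} {w : List ι} {p q : α} {L : List (ι × α × α)} :
    L ∈ walks (j :: w) p q ↔ ∃ v, ∃ L' ∈ walks w v q, (j, p, v) :: L' = L := by
  simp [walks]

theorem isWalk_of_mem_walks {w : List ι} {p q : α} {L : List (ι × α × α)}
    (h : L ∈ walks w p q) : IsWalk p L q := by
  induction w generalizing p L with
  | nil =>
    rw [walks] at h
    split_ifs at h with hp
    · obtain rfl := Finset.mem_singleton.1 h; exact hp
    · simp at h
  | cons j w ih =>
    obtain ⟨v, L', hL', rfl⟩ := mem_walks_cons.1 h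
    exact ⟨rfl, ih hL'⟩

theorem length_of_mem_walks {w : List ι} {p q : α} {L : List (ι × α × α)}
    (h : L ∈ walks w p q) : L.length = w.length := by
  induction w generalizing p L with
  | nil =>
    rw [walks] at h
    split_ifs at h with hp
    · obtain rfl := Finset.mem_singleton.1 h; rfl
    · simp at h
  | cons j w ih =>
    obtain ⟨v, L', hL', rfl⟩ := mem_walks_cons.1 h
    simp [ih hL']

/-- Colours, start and successive targets determine a walk; this gives the injectivity required to
count walks by their vertex lists. -/
theorem eq_of_mem_walks {w : List ι} {p q q' : α} {L L' : List (ι × α × α)}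
    (h : L ∈ walks w p q) (h' : L' ∈ walks w p q')
    (ht : L.map (fun d => d.2.2) = L'.map fun d => d.2.2) : L = L' := by
  induction w generalizing p L L' with
  | nil =>
    have h1 := length_of_mem_walks h
    have h2 := length_of_mem_walks h'
    rw [List.length_nil, List.length_eq_zero_iff] at h1 h2
    rw [h1, h2]
  | cons j w ih =>
    obtain ⟨v, L1, hL1, rfl⟩ := mem_walks_cons.1 h
    obtain ⟨v', L2, hL2, rfl⟩ := mem_walks_cons.1 h'
    simp only [List.map_cons, List.cons.injEq] at ht
    obtain ⟨rfl, ht⟩ := ht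
    rw [ih hL1 hL2 ht]

/-- Cutting a walk at a step amounts to cutting its word at a letter and choosing the two endpoints
of that step. -/
theorem sum_walks_splitSum (w : List ι) (v p : α)
    (G : List (ι × α × α) → ι × α × α → List (ι × α × α) → ℝ) :
    ∑ L ∈ walks w v p, splitSum L G = splitSum w fun u i z =>
      ∑ x, ∑ y, ∑ L1 ∈ walks u v x, ∑ L2 ∈ walks z y p, G L1 (i, x, y) L2 := by
  induction w generalizing v G with
  | nil => rw [sum_walks_nil]; simp [splitSum]
  | cons j w ih =>
    rw [sum_walks_cons]
    simp only [splitSum, Finset.sum_add_distrib, ih, sum_walks_nil]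
    congr 1
    · conv_rhs => rw [Finset.sum_comm]
      refine Finset.sum_congr rfl fun y _ => ?_
      rw [Finset.sum_ite_eq, if_pos (Finset.mem_univ _)]
    · rw [sum_splitSum]
      refine splitSum_congr fun u i z _ => ?_
      rw [Finset.sum_comm]
      refine Finset.sum_congr rfl fun x _ => ?_
      rw [Finset.sum_comm]
      refine Finset.sum_congr rfl fun y _ => ?_
      rw [sum_walks_cons]

/-- The symmetric matrices whose entries are listed by `y`. -/
def edgeMatrix {R : Type*} (y : ι × Sym2 α → R) (j : ι) : Matrix α α R :=
  Matrix.of fun a b => y (j, s(a, b))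

theorem prod_edgeMatrix_apply {R : Type*} [CommSemiring R] (y : ι × Sym2 α → R) (w : List ι)
    (p q : α) : (w.map (edgeMatrix y)).prod p q =
      ∑ L ∈ walks w p q, ((L.map stepEdge).map y).prod := by
  induction w generalizing p with
  | nil => rw [sum_walks_nil, List.map_nil, List.prod_nil, Matrix.one_apply]; simp
  | cons j w ih =>
    rw [sum_walks_cons, List.map_cons, List.prod_cons, Matrix.mul_apply]
    refine Finset.sum_congr rfl fun v _ => ?_
    rw [ih, Finset.mul_sum]
    refine Finset.sum_congr rfl fun L _ => ?_
    simp [edgeMatrix, stepEdge]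

/-- A family of lists of length `r` with few distinct entries each is small. -/
theorem card_le_of_few_values [Nonempty α] {σ : Type*} (S : Finset σ) (g : σ → List α) {r M : ℕ}
    (hlen : ∀ s ∈ S, (g s).length = r) (hinj : Set.InjOn g S)
    (hfew : ∀ s ∈ S, 2 * (g s).toFinset.card ≤ M) :
    (S.card : ℝ) ≤ ((M / 2 : ℕ) : ℝ) ^ r * Real.sqrt (Fintype.card α) ^ M := by
  classical
  -- Each list is coded by a labelling of its positions by `Fin (M / 2)` together with a value for
  -- every label; unused labels get an arbitrary value.
  have h1 : S.image g ⊆ (Finset.univ : Finset ((Fin r → Fin (M / 2)) × (Fin (M / 2) → α))).image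
      fun h => List.ofFn (h.2 ∘ h.1) := by
    intro l hl
    obtain ⟨s, hs, rfl⟩ := Finset.mem_image.1 hl
    have hle : Fintype.card {x // x ∈ (g s).toFinset} ≤ Fintype.card (Fin (M / 2)) := by
      rw [Fintype.card_coe, Fintype.card_fin]
      have := hfew s hs
      omega
    obtain ⟨φ⟩ := Function.Embedding.nonempty_of_card_le hle
    refine Finset.mem_image.2 ⟨(fun i => φ ⟨(g s)[i]'(by rw [hlen s hs]; exact i.2),
      by simp⟩, Function.extend φ Subtype.val fun _ => Classical.arbitrary α),
      Finset.mem_univ _, ?_⟩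
    refine List.ext_getElem (by simp [hlen s hs]) fun i h1 h2 => ?_
    rw [List.getElem_ofFn, Function.comp_apply]
    dsimp only
    rw [φ.injective.extend_apply]
    rfl
  have h2 : S.card ≤ (M / 2) ^ r * Fintype.card α ^ (M / 2) := by
    rw [← Finset.card_image_of_injOn hinj]
    refine (Finset.card_le_card h1).trans (Finset.card_image_le.trans ?_)
    simp
  have h3 : (1 : ℝ) ≤ Real.sqrt (Fintype.card α) := by
    rw [Real.one_le_sqrt]; exact_mod_cast Fintype.card_pos
  calc (S.card : ℝ) ≤ ((M / 2 : ℕ) : ℝ) ^ r * (Fintype.card α : ℝ) ^ (M / 2) := by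
        exact_mod_cast h2
    _ = ((M / 2 : ℕ) : ℝ) ^ r * Real.sqrt (Fintype.card α) ^ (2 * (M / 2)) := by
        rw [pow_mul, Real.sq_sqrt (Nat.cast_nonneg _)]
    _ ≤ _ := by
        exact mul_le_mul_of_nonneg_left (pow_le_pow_right₀ h3 (by omega)) (by positivity)

/-- The common source of the error terms: bounded summands, nonzero only on configurations with at
most `M / 2` vertices, contribute at most a constant times `√n ^ M`. -/
theorem abs_sum_le_of_few_values [Nonempty α] {σ : Type*} (S : Finset σ) (f : σ → ℝ)
    (g : σ → List α) {r M : ℕ} {K : ℝ} (hK : ∀ s ∈ S, |f s| ≤ K) (hK0 : 0 ≤ K)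
    (hlen : ∀ s ∈ S, (g s).length = r) (hinj : Set.InjOn g S)
    (hfew : ∀ s ∈ S, f s ≠ 0 → 2 * (g s).toFinset.card ≤ M) :
    |∑ s ∈ S, f s| ≤ K * ((M / 2 : ℕ) : ℝ) ^ r * Real.sqrt (Fintype.card α) ^ M := by
  classical
  rw [← Finset.sum_filter_ne_zero]
  have hsub : S.filter (fun s => f s ≠ 0) ⊆ S := Finset.filter_subset _ _
  calc |∑ s ∈ S.filter (fun s => f s ≠ 0), f s|
      ≤ ∑ s ∈ S.filter (fun s => f s ≠ 0), |f s| := Finset.abs_sum_le_sum_abs _ _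
    _ ≤ (S.filter (fun s => f s ≠ 0)).card • K :=
        Finset.sum_le_card_nsmul _ _ _ fun s hs => hK s (hsub hs)
    _ = K * (S.filter (fun s => f s ≠ 0)).card := by rw [nsmul_eq_mul, mul_comm]
    _ ≤ K * (((M / 2 : ℕ) : ℝ) ^ r * Real.sqrt (Fintype.card α) ^ M) := by
        refine mul_le_mul_of_nonneg_left (card_le_of_few_values _ g (fun s hs => hlen s (hsub hs))
          (hinj.mono hsub) fun s hs => hfew s (hsub hs) (Finset.mem_filter.1 hs).2) hK0
    _ = _ := by ring

end Walks

/-! ### Approximate Schwinger-Dyson equation and decorrelation of traces -/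

section TraceMoments

variable {ι α : Type*} [Fintype ι] [DecidableEq ι] [Fintype α] [DecidableEq α]

/-- The expected trace of a word in the matrices with entries of moments `μ`. -/
def traceMoment (μ : ι × Sym2 α → ℕ → ℝ) (w : List ι) : ℝ :=
  ∑ p, ∑ L ∈ walks w p p, mixedMoment μ (L.map stepEdge)

/-- The expected product of the traces of two words. -/
def traceMoment₂ (μ : ι × Sym2 α → ℕ → ℝ) (u z : List ι) : ℝ :=
  ∑ p, ∑ q, ∑ L ∈ walks u p p, ∑ L' ∈ walks z q q,
    mixedMoment μ (L.map stepEdge ++ L'.map stepEdge)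

/-- The moments of independent centered variables indexed by coloured edges, which vanish on loops
and have unit variance off loops. -/
structure IsEdgeMoment (μ : ι × Sym2 α → ℕ → ℝ) (B : ℕ → ℝ) : Prop where
  zero : ∀ c, μ c 0 = 1
  one : ∀ c, μ c 1 = 0
  two : ∀ c : ι × Sym2 α, ¬ c.2.IsDiag → μ c 2 = 1
  diag : ∀ c : ι × Sym2 α, c.2.IsDiag → ∀ k, k ≠ 0 → μ c k = 0
  mono : Monotone B
  one_le : ∀ k, 1 ≤ B k
  abs_le : ∀ c k, |μ c k| ≤ B k

variable {μ : ι × Sym2 α → ℕ → ℝ} {B : ℕ → ℝ}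

theorem IsEdgeMoment.abs_mixedMoment_le (h : IsEdgeMoment μ B) {L : List (ι × Sym2 α)} {k : ℕ}
    (hk : L.length ≤ k) : |mixedMoment μ L| ≤ B k ^ k :=
  (NCProb.abs_mixedMoment_le h.mono h.one_le h.zero h.abs_le L).trans
    ((pow_le_pow_left₀ (zero_le_one.trans (h.one_le _)) (h.mono hk) _).trans
      (pow_le_pow_right₀ (h.one_le _) hk))

theorem walkVerts_eq_toFinset (p : α) (L : List (ι × α × α)) :
    walkVerts p L = (p :: L.map fun d => d.2.2).toFinset := by
  rw [walkVerts, List.toFinset_cons]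

/-- Only pairs of closed walks whose moment does not factorize contribute, and these have few
vertices by `IsWalk.two_mul_card_union_le_of_ne`. The natural scale is `√n ^ (u.length + z.length +
4)`, so three factors `√n` are gained. -/
theorem IsEdgeMoment.abs_traceMoment₂_sub_le [Nonempty α] (h : IsEdgeMoment μ B)
    (u z : List ι) :
    |traceMoment₂ μ u z - traceMoment μ u * traceMoment μ z| ≤
      2 * (B (u.length + z.length) ^ (u.length + z.length)) ^ 2 *
        (((u.length + z.length + 1) / 2 : ℕ) : ℝ) ^ (u.length + z.length + 2) *
          Real.sqrt (Fintype.card α) ^ (u.length + z.length + 1) := by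
  set k := u.length + z.length with hk
  set S : Finset ((_ : α × α) × (List (ι × α × α) × List (ι × α × α))) :=
    (Finset.univ : Finset (α × α)).sigma fun pq => walks u pq.1 pq.1 ×ˢ walks z pq.2 pq.2 with hS
  have hmem : ∀ s ∈ S, s.2.1 ∈ walks u s.1.1 s.1.1 ∧ s.2.2 ∈ walks z s.1.2 s.1.2 := by
    intro s hs
    simpa [hS] using hs
  have hsum : traceMoment₂ μ u z - traceMoment μ u * traceMoment μ z =
      ∑ s ∈ S, (mixedMoment μ (s.2.1.map stepEdge ++ s.2.2.map stepEdge) -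
        mixedMoment μ (s.2.1.map stepEdge) * mixedMoment μ (s.2.2.map stepEdge)) := by
    rw [Finset.sum_sigma, ← Finset.univ_product_univ, Finset.sum_product]
    simp only [Finset.sum_product, Finset.sum_sub_distrib, traceMoment₂, traceMoment,
      Finset.sum_mul_sum]
  rw [hsum]
  have hB1 : 1 ≤ B k ^ k := one_le_pow₀ (h.one_le _)
  refine abs_sum_le_of_few_values S _
    (fun s => s.1.1 :: (s.2.1.map fun d => d.2.2) ++ s.1.2 :: s.2.2.map fun d => d.2.2)
    ?_ (by positivity) ?_ ?_ ?_
  · intro s hs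
    obtain ⟨h1, h2⟩ := hmem s hs
    have l1 := length_of_mem_walks h1
    have l2 := length_of_mem_walks h2
    have b1 := h.abs_mixedMoment_le (L := s.2.1.map stepEdge ++ s.2.2.map stepEdge) (k := k)
      (by simp [l1, l2, hk])
    have b2 := h.abs_mixedMoment_le (L := s.2.1.map stepEdge) (k := k) (by simp [l1, hk])
    have b3 := h.abs_mixedMoment_le (L := s.2.2.map stepEdge) (k := k) (by simp [l2, hk])
    refine (abs_sub _ _).trans ?_
    rw [abs_mul]
    nlinarith [mul_le_mul b2 b3 (abs_nonneg _) (by linarith)]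
  · intro s hs
    obtain ⟨h1, h2⟩ := hmem s hs
    simp [length_of_mem_walks h1, length_of_mem_walks h2, hk]
    ring
  · rintro ⟨⟨p, q⟩, L, L'⟩ hs ⟨⟨p', q'⟩, N, N'⟩ hs' he
    obtain ⟨h1, h2⟩ := hmem _ hs
    obtain ⟨h1', h2'⟩ := hmem _ hs'
    dsimp only at h1 h2 h1' h2' he
    obtain ⟨e1, e2⟩ := List.append_inj he (by
      simp [length_of_mem_walks h1, length_of_mem_walks h1'])
    simp only [List.cons.injEq] at e1 e2
    obtain ⟨rfl, e1⟩ := e1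
    obtain ⟨rfl, e2⟩ := e2
    obtain rfl := eq_of_mem_walks h1 h1' e1
    obtain rfl := eq_of_mem_walks h2 h2' e2
    rfl
  · intro s hs hne
    obtain ⟨h1, h2⟩ := hmem s hs
    have := (isWalk_of_mem_walks h1).two_mul_card_union_le_of_ne h.zero h.one
      (isWalk_of_mem_walks h2) (sub_ne_zero.1 hne)
    rw [length_of_mem_walks h1, length_of_mem_walks h2, ← hk] at this
    rw [List.toFinset_append, ← walkVerts_eq_toFinset, ← walkVerts_eq_toFinset]
    exact this

/-- The pairings of the first letter of a word with a later letter. -/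
theorem IsEdgeMoment.abs_traceMoment_cons_sub_aux [Nonempty α] (h : IsEdgeMoment μ B) (j : ι)
    (w : List ι) :
    |traceMoment μ (j :: w) - ∑ p, ∑ v, ∑ L ∈ walks w v p, (if p = v then 0 else
        ((L.map stepEdge).count (j, s(p, v)) : ℝ) *
          mixedMoment μ ((L.map stepEdge).erase (j, s(p, v))))| ≤
      ((w.length + 1) * B (w.length + 1) ^ (w.length + 1)) *
        (((w.length + 2) / 2 : ℕ) : ℝ) ^ (w.length + 2) *
          Real.sqrt (Fintype.card α) ^ (w.length + 2) := by
  set k := w.length + 1 with hk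
  set S : Finset ((_ : α × α) × List (ι × α × α)) :=
    (Finset.univ : Finset (α × α)).sigma fun pv => walks w pv.2 pv.1 with hS
  have hmem : ∀ s ∈ S, s.2 ∈ walks w s.1.2 s.1.1 := by
    intro s hs
    simpa [hS] using hs
  have hsum : traceMoment μ (j :: w) - ∑ p, ∑ v, ∑ L ∈ walks w v p, (if p = v then 0 else
        ((L.map stepEdge).count (j, s(p, v)) : ℝ) *
          mixedMoment μ ((L.map stepEdge).erase (j, s(p, v)))) =
      ∑ s ∈ S, (mixedMoment μ ((j, s(s.1.1, s.1.2)) :: s.2.map stepEdge) -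
        if s.1.1 = s.1.2 then 0 else
        ((s.2.map stepEdge).count (j, s(s.1.1, s.1.2)) : ℝ) *
          mixedMoment μ ((s.2.map stepEdge).erase (j, s(s.1.1, s.1.2)))) := by
    rw [Finset.sum_sigma, ← Finset.univ_product_univ, Finset.sum_product]
    simp only [Finset.sum_sub_distrib, traceMoment, sum_walks_cons]
    rfl
  rw [hsum]
  have hB1 : 1 ≤ B k ^ k := one_le_pow₀ (h.one_le _)
  refine abs_sum_le_of_few_values S _
    (fun s => s.1.1 :: s.1.2 :: (s.2.map fun d => d.2.2)) ?_ (by positivity) ?_ ?_ ?_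
  · intro s hs
    have h1 := hmem s hs
    have l1 := length_of_mem_walks h1
    have b1 := h.abs_mixedMoment_le (L := (j, s(s.1.1, s.1.2)) :: s.2.map stepEdge) (k := k)
      (by simp [l1, hk])
    split_ifs with hpv
    · rw [sub_zero]
      refine b1.trans (le_mul_of_one_le_left (by linarith) ?_)
      linarith [(Nat.cast_nonneg w.length : (0 : ℝ) ≤ w.length)]
    · have b2 := h.abs_mixedMoment_le (L := (s.2.map stepEdge).erase (j, s(s.1.1, s.1.2)))
        (k := k) (by
          refine (List.length_erase_le).trans ?_
          simp [l1, hk])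
      have hc : ((s.2.map stepEdge).count (j, s(s.1.1, s.1.2)) : ℝ) ≤ w.length := by
        have := (s.2.map stepEdge).count_le_length (a := (j, s(s.1.1, s.1.2)))
        rw [List.length_map, l1] at this
        exact_mod_cast this
      refine (abs_sub _ _).trans ?_
      rw [abs_mul, Nat.abs_cast]
      nlinarith [mul_le_mul hc b2 (abs_nonneg _) (Nat.cast_nonneg _)]
  · intro s hs
    simp [length_of_mem_walks (hmem s hs)]
  · rintro ⟨⟨p, q⟩, L⟩ hs ⟨⟨p', q'⟩, N⟩ hs' he
    have h1 := hmem _ hs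
    have h1' := hmem _ hs'
    dsimp only at h1 h1' he
    simp only [List.cons.injEq] at he
    obtain ⟨rfl, rfl, he⟩ := he
    obtain rfl := eq_of_mem_walks h1 h1' he
    rfl
  · intro s hs hne
    have h1 := hmem s hs
    by_cases hpv : s.1.1 = s.1.2
    · refine absurd ?_ hne
      rw [if_pos hpv, sub_zero]
      refine Finset.prod_eq_zero (Finset.mem_univ (j, s(s.1.1, s.1.2))) (h.diag _ ?_ _ ?_)
      · simpa using hpv
      · rw [List.count_cons_self]; omega
    · by_contra hbig
      refine hne ?_
      rw [if_neg hpv, sub_eq_zero]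
      refine (isWalk_of_mem_walks h1).mixedMoment_cons h.zero h.one (h.two _ (by simpa using hpv)) ?_
      rw [walkVerts_eq_toFinset, length_of_mem_walks h1]
      simpa using hbig

/-- The constraint `x = v ∧ y = p` says that the step from `x` to `y` traverses the first edge, from
`p` to `v`, backwards; the two remaining walks are then closed. -/
theorem traceMoment₂_eq_sum_ite (u z : List ι) :
    traceMoment₂ μ u z = ∑ p, ∑ v, ∑ x, ∑ y, ∑ L1 ∈ walks u v x, ∑ L2 ∈ walks z y p,
      if x = v ∧ y = p then mixedMoment μ (L1.map stepEdge ++ L2.map stepEdge) else 0 := by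
  rw [traceMoment₂, Finset.sum_comm]
  refine Finset.sum_congr rfl fun p _ => Finset.sum_congr rfl fun v _ => ?_
  rw [Finset.sum_eq_single v, Finset.sum_eq_single p]
  · simp
  · intro y _ hy; simp [hy]
  · simp
  · intro x _ hx; simp [hx]
  · simp

/-- The step from `x` to `y` uses the edge of `p` and `v` in one of two directions. Backwards, it
leaves two closed walks, the main term. Forwards, it leaves two walks from `v` to `p`, whose union
is connected and therefore has few vertices. -/
theorem IsEdgeMoment.abs_pairing_sub_le [Nonempty α] (h : IsEdgeMoment μ B) (j i : ι)
    (u z : List ι) :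
    |(∑ p, ∑ v, ∑ x, ∑ y, ∑ L1 ∈ walks u v x, ∑ L2 ∈ walks z y p,
        if p ≠ v ∧ stepEdge (i, x, y) = (j, s(p, v)) then
          mixedMoment μ (L1.map stepEdge ++ L2.map stepEdge) else 0) -
      (if i = j then traceMoment₂ μ u z else 0)| ≤
      B (u.length + z.length) ^ (u.length + z.length) *
        (((u.length + z.length + 2) / 2 : ℕ) : ℝ) ^ (u.length + z.length + 4) *
          Real.sqrt (Fintype.card α) ^ (u.length + z.length + 2) := by
  set k := u.length + z.length with hk
  have hB1 : 1 ≤ B k ^ k := one_le_pow₀ (h.one_le _)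
  by_cases hij : i = j
  swap
  · rw [if_neg hij]
    have : ∀ p v x y : α, ¬ (p ≠ v ∧ stepEdge (i, x, y) = (j, s(p, v))) := by
      rintro p v x y ⟨-, h⟩
      exact hij (congrArg Prod.fst h)
    simp only [if_neg (this _ _ _ _), Finset.sum_const_zero, sub_zero, abs_zero]
    positivity
  subst hij
  rw [if_pos rfl, traceMoment₂_eq_sum_ite]
  set S : Finset ((_ : α × α × α × α) × (List (ι × α × α) × List (ι × α × α))) :=
    (Finset.univ : Finset (α × α × α × α)).sigma fun t =>
      walks u t.2.1 t.2.2.1 ×ˢ walks z t.2.2.2 t.1 with hS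
  have hmem : ∀ s ∈ S, s.2.1 ∈ walks u s.1.2.1 s.1.2.2.1 ∧ s.2.2 ∈ walks z s.1.2.2.2 s.1.1 := by
    intro s hs
    simpa [hS] using hs
  have hsum (P Q : α → α → α → α → Prop) [∀ p v x y, Decidable (P p v x y)]
      [∀ p v x y, Decidable (Q p v x y)] :
      (∑ p, ∑ v, ∑ x, ∑ y, ∑ L1 ∈ walks u v x, ∑ L2 ∈ walks z y p,
        if P p v x y then mixedMoment μ (L1.map stepEdge ++ L2.map stepEdge) else 0) -
      (∑ p, ∑ v, ∑ x, ∑ y, ∑ L1 ∈ walks u v x, ∑ L2 ∈ walks z y p,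
        if Q p v x y then mixedMoment μ (L1.map stepEdge ++ L2.map stepEdge) else 0) =
      ∑ s ∈ S, ((if P s.1.1 s.1.2.1 s.1.2.2.1 s.1.2.2.2 then
          mixedMoment μ (s.2.1.map stepEdge ++ s.2.2.map stepEdge) else 0) -
        if Q s.1.1 s.1.2.1 s.1.2.2.1 s.1.2.2.2 then
          mixedMoment μ (s.2.1.map stepEdge ++ s.2.2.map stepEdge) else 0) := by
    rw [Finset.sum_sigma]
    simp only [← Finset.univ_product_univ, Finset.sum_product, Finset.sum_sub_distrib]
  rw [hsum]
  refine abs_sum_le_of_few_values S _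
    (fun s => s.1.1 :: s.1.2.1 :: s.1.2.2.1 :: s.1.2.2.2 ::
      ((s.2.1.map fun d => d.2.2) ++ s.2.2.map fun d => d.2.2)) ?_ (by positivity) ?_ ?_ ?_
  · intro s hs
    obtain ⟨h1, h2⟩ := hmem s hs
    have l1 := length_of_mem_walks h1
    have l2 := length_of_mem_walks h2
    have b1 := h.abs_mixedMoment_le (L := s.2.1.map stepEdge ++ s.2.2.map stepEdge) (k := k)
      (by simp [l1, l2, hk])
    split_ifs <;> simp only [sub_self, sub_zero, zero_sub, abs_neg, abs_zero] <;> linarith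
  · intro s hs
    obtain ⟨h1, h2⟩ := hmem s hs
    simp [length_of_mem_walks h1, length_of_mem_walks h2, hk]
  · rintro ⟨⟨p, v, x, y⟩, L, L'⟩ hs ⟨⟨p', v', x', y'⟩, N, N'⟩ hs' he
    obtain ⟨h1, h2⟩ := hmem _ hs
    obtain ⟨h1', h2'⟩ := hmem _ hs'
    dsimp only at h1 h2 h1' h2' he
    simp only [List.cons.injEq] at he
    obtain ⟨rfl, rfl, rfl, rfl, he⟩ := he
    obtain ⟨e1, e2⟩ := List.append_inj he (by
      simp [length_of_mem_walks h1, length_of_mem_walks h1'])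
    obtain rfl := eq_of_mem_walks h1 h1' e1
    obtain rfl := eq_of_mem_walks h2 h2' e2
    rfl
  · rintro ⟨⟨p, v, x, y⟩, L, L'⟩ hs hne
    obtain ⟨h1, h2⟩ := hmem _ hs
    dsimp only at h1 h2 hne ⊢
    have hmm : mixedMoment μ (L.map stepEdge ++ L'.map stepEdge) ≠ 0 := by
      intro h0
      simp [h0] at hne
    -- If `y ≠ v`, the forward direction is excluded, both indicators agree and the summand is zero.
    -- The remaining case `y = v` also covers the degenerate `p = v`.
    have hyv : y = v := by
      by_contra hyv
      refine hne ?_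
      have : (p ≠ v ∧ stepEdge (i, x, y) = (i, s(p, v))) ↔ (x = v ∧ y = p) := by
        simp only [stepEdge, Prod.mk.injEq, true_and, Sym2.eq_iff]
        constructor
        · rintro ⟨-, ⟨rfl, rfl⟩ | h⟩
          · exact absurd rfl hyv
          · exact h
        · rintro ⟨rfl, rfl⟩
          exact ⟨hyv, Or.inr ⟨rfl, rfl⟩⟩
      simp only [this, sub_self]
    subst hyv
    have key := (isWalk_of_mem_walks h1).two_mul_card_union_le h.one (isWalk_of_mem_walks h2) hmm
    rw [length_of_mem_walks h1, length_of_mem_walks h2, ← hk] at key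
    refine le_trans (Nat.mul_le_mul_left 2 (Finset.card_le_card ?_)) key
    have hx := (isWalk_of_mem_walks h1).end_mem
    have hp := (isWalk_of_mem_walks h2).end_mem
    intro a ha
    rw [List.mem_toFinset] at ha
    simp only [List.mem_cons, List.mem_append] at ha
    simp only [walkVerts_eq_toFinset, Finset.mem_union, List.mem_toFinset, List.mem_cons]
      at hx hp ⊢
    rcases ha with rfl | rfl | rfl | rfl | ha | ha <;> tauto

/-- The approximate Schwinger-Dyson equation for expected traces. -/
theorem IsEdgeMoment.abs_traceMoment_cons_sub_le (B : ℕ → ℝ) (w : List ι) : ∃ K : ℝ,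
    ∀ {α : Type} [Fintype α] [DecidableEq α] [Nonempty α] {μ : ι × Sym2 α → ℕ → ℝ}
      (_ : IsEdgeMoment μ B) (j : ι),
    |traceMoment μ (j :: w) -
        splitSum w fun u i z => if i = j then traceMoment₂ μ u z else 0| ≤
      K * Real.sqrt (Fintype.card α) ^ (w.length + 2) := by
  set k := w.length with hk
  -- The first summand comes from walks whose first edge is not paired exactly once, the second from
  -- the forward pairings, one for each of the `k` letters of `w`.
  refine ⟨((k + 1) * B (k + 1) ^ (k + 1)) * (((k + 2) / 2 : ℕ) : ℝ) ^ (k + 2) +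
    k * (B (k + 1) ^ (k + 1) * (((k + 2) / 2 : ℕ) : ℝ) ^ (k + 3)), ?_⟩
  intro α _ _ _ μ h j
  have h1 := h.abs_traceMoment_cons_sub_aux j w
  have h2 : ∑ p, ∑ v, ∑ L ∈ walks w v p, (if p = v then 0 else
        ((L.map stepEdge).count (j, s(p, v)) : ℝ) *
          mixedMoment μ ((L.map stepEdge).erase (j, s(p, v)))) =
      splitSum w fun u i z => ∑ p, ∑ v, ∑ x, ∑ y, ∑ L1 ∈ walks u v x, ∑ L2 ∈ walks z y p,
        if p ≠ v ∧ stepEdge (i, x, y) = (j, s(p, v)) then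
          mixedMoment μ (L1.map stepEdge ++ L2.map stepEdge) else 0 := by
    rw [← sum_splitSum]
    refine Finset.sum_congr rfl fun p _ => ?_
    rw [← sum_splitSum]
    refine Finset.sum_congr rfl fun v _ => ?_
    rw [← sum_walks_splitSum w v p fun L1 d L2 => if p ≠ v ∧ stepEdge d = (j, s(p, v)) then
          mixedMoment μ (L1.map stepEdge ++ L2.map stepEdge) else 0]
    refine Finset.sum_congr rfl fun L _ => ?_
    by_cases hpv : p = v
    · simp only [hpv, ne_eq, not_true_eq_false, false_and, if_true, if_false]
      exact (splitSum_zero L).symm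
    · rw [if_neg hpv, ← splitSum_erase stepEdge _ (fun l l' h => mixedMoment_perm h)]
      simp only [ne_eq, hpv, not_false_eq_true, true_and]
  rw [h2] at h1
  have hs1 : 1 ≤ Real.sqrt (Fintype.card α) := by
    rw [Real.one_le_sqrt]; exact_mod_cast Fintype.card_pos
  have hBp : 0 ≤ B (k + 1) := zero_le_one.trans (h.one_le _)
  have h3 := abs_splitSum_sub_le (L := w)
    (G := fun u i z => ∑ p, ∑ v, ∑ x, ∑ y, ∑ L1 ∈ walks u v x, ∑ L2 ∈ walks z y p,
        if p ≠ v ∧ stepEdge (i, x, y) = (j, s(p, v)) then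
          mixedMoment μ (L1.map stepEdge ++ L2.map stepEdge) else 0)
    (H := fun u i z => if i = j then traceMoment₂ μ u z else 0)
    (K := B (k + 1) ^ (k + 1) * (((k + 2) / 2 : ℕ) : ℝ) ^ (k + 3) *
      Real.sqrt (Fintype.card α) ^ (k + 2)) (by
      intro u i z hw
      have hl : u.length + z.length + 1 = k := by rw [hk, hw]; simp; ring
      refine (h.abs_pairing_sub_le j i u z).trans ?_
      have e : u.length + z.length + 4 = k + 3 := by omega
      rw [e]
      have hle : ((u.length + z.length + 2) / 2 : ℕ) ≤ (k + 2) / 2 := by omega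
      have hB1 := h.one_le
      have : B (u.length + z.length) ^ (u.length + z.length) ≤ B (k + 1) ^ (k + 1) :=
        (pow_le_pow_left₀ (zero_le_one.trans (h.one_le _)) (h.mono (by omega)) _).trans
          (pow_le_pow_right₀ (h.one_le _) (by omega))
      have : Real.sqrt (Fintype.card α) ^ (u.length + z.length + 2) ≤
          Real.sqrt (Fintype.card α) ^ (k + 2) := pow_le_pow_right₀ hs1 (by omega)
      have : (((u.length + z.length + 2) / 2 : ℕ) : ℝ) ^ (k + 3) ≤
        (((k + 2) / 2 : ℕ) : ℝ) ^ (k + 3) := pow_le_pow_left₀ (by positivity)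
          (by exact_mod_cast hle) _
      gcongr)
  refine (abs_sub_le _ _ _).trans ((add_le_add h1 h3).trans (le_of_eq ?_))
  rw [← hk]; ring

end TraceMoments

/-! ### The limiting functional: free semicircular elements -/

section FockCoeff

variable {ι : Type*} [DecidableEq ι]

/-- The coefficient of the basis vector `v` of the free Fock space in the vector obtained by
applying the word `w` in the field operators to the vacuum. -/
def fockCoeff : List ι → List ι → ℝ
  | [], v => if v = [] then 1 else 0
  | i :: w, [] => fockCoeff w [i]
  | i :: w, k :: v => fockCoeff w (i :: k :: v) + if i = k then fockCoeff w v else 0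

theorem splitSum_add {β : Type*} (L : List β) (G H : List β → β → List β → ℝ) :
    splitSum L (fun u d v => G u d v + H u d v) = splitSum L G + splitSum L H := by
  induction L generalizing G H with
  | nil => simp [splitSum]
  | cons d L ih => simp only [splitSum, ih]; ring

/-- The letter `j` of the final vector was created by a definite letter of `w = u ++ j :: z`. The
operators in `z`, which act first, have produced `q` by then, and those in `u` build `v` on top
without touching `j`. -/
theorem fockCoeff_append_cons (w v q : List ι) (j : ι) :
    fockCoeff w (v ++ j :: q) =
      splitSum w fun u i z => if i = j then fockCoeff u v * fockCoeff z q else 0 := by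
  induction w generalizing v with
  | nil => simp [fockCoeff, splitSum]
  | cons i w ih =>
    rw [splitSum]
    cases v with
    | nil =>
      simp only [List.nil_append, fockCoeff, if_true, one_mul]
      rw [add_comm]
      congr 1
      exact ih [i]
    | cons k v =>
      have h1 := ih (i :: k :: v)
      simp only [List.cons_append] at h1
      simp only [List.cons_append, fockCoeff, reduceCtorEq, if_false, zero_mul, ite_self,
        zero_add, h1]
      by_cases hik : i = k
      · simp only [hik, if_true, ih v, ← splitSum_add]
        refine splitSum_congr fun u i z _ => ?_
        split_ifs <;> ring
      · simp only [hik, if_false, add_zero]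

/-- The exact Schwinger-Dyson equation: the first letter annihilates the letter `j` created by its
partner. -/
theorem fockCoeff_cons_nil (j : ι) (w : List ι) :
    fockCoeff (j :: w) [] =
      splitSum w fun u i z => if i = j then fockCoeff u [] * fockCoeff z [] else 0 :=
  fockCoeff_append_cons w [] [] j

end FockCoeff

/-! ### Chebyshev polynomials and moments of free semicircular elements -/

section Semicircle

open Polynomial Polynomial.Chebyshev

/-- After `x = 2y` the identity `(1 - y²) U_q = (T_q - T_{q+2}) / 2` replaces the semicircle weight
by the arcsine weight, against which `T_q` and `T_{q+2}` integrate to zero. -/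
theorem integral_semicircle_chebyshev_S {q : ℕ} (hq : q ≠ 0) :
    ∫ x in (-2 : ℝ)..2, (S ℝ q).eval x * (Real.sqrt (4 - x ^ 2) / (2 * Real.pi)) = 0 := by
  have h1 := intervalIntegral.integral_comp_mul_left (a := -1) (b := 1)
    (fun x => (S ℝ q).eval x * (Real.sqrt (4 - x ^ 2) / (2 * Real.pi))) (c := (2 : ℝ)) (by norm_num)
  rw [show (2 : ℝ) * -1 = -2 by norm_num, show (2 : ℝ) * 1 = 2 by norm_num] at h1
  have h2 : ∫ x in (-1 : ℝ)..1, (S ℝ q).eval (2 * x) *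
      (Real.sqrt (4 - (2 * x) ^ 2) / (2 * Real.pi)) =
      ∫ x in (-1 : ℝ)..1, ((T ℝ q).eval x * (2 * Real.pi)⁻¹ -
        (T ℝ (q + 2)).eval x * (2 * Real.pi)⁻¹) * Real.sqrt (1 - x ^ 2)⁻¹ := by
    refine intervalIntegral.integral_congr fun x hx => ?_
    rw [Set.uIcc_of_le (by norm_num)] at hx
    have hx0 : 0 ≤ 1 - x ^ 2 := by nlinarith [hx.1, hx.2]
    have e1 : (S ℝ q).eval (2 * x) = (U ℝ q).eval x := by
      rw [← S_comp_two_mul_X]; simp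
    have e2 : Real.sqrt (4 - (2 * x) ^ 2) = 2 * Real.sqrt (1 - x ^ 2) := by
      rw [show 4 - (2 * x) ^ 2 = 2 ^ 2 * (1 - x ^ 2) by ring, Real.sqrt_mul (by norm_num),
        Real.sqrt_sq (by norm_num)]
    have e3 : Real.sqrt (1 - x ^ 2) = (1 - x ^ 2) * Real.sqrt (1 - x ^ 2)⁻¹ := by
      rw [Real.sqrt_inv]
      rcases hx0.eq_or_lt with h | h
      · rw [← h]; simp
      · have := Real.sqrt_pos.2 h
        field_simp
        rw [Real.sq_sqrt hx0]
    have e4 : (1 - x ^ 2) * (U ℝ q).eval x = ((T ℝ q).eval x - (T ℝ (q + 2)).eval x) / 2 := by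
      have h := congrArg (Polynomial.eval x) (one_sub_X_sq_mul_U_eq_pol_in_T ℝ (q : ℤ))
      rw [T_add_two] at h ⊢
      simp only [eval_mul, eval_sub, eval_one, eval_pow, eval_X, eval_ofNat] at h ⊢
      linarith
    rw [e1, e2]
    nth_rw 1 [e3]
    have hpi := Real.pi_ne_zero
    calc _ = ((1 - x ^ 2) * (U ℝ q).eval x) * Real.sqrt (1 - x ^ 2)⁻¹ * Real.pi⁻¹ := by
          field_simp
      _ = _ := by rw [e4]; field_simp
  have h3 : ∫ x in (-1 : ℝ)..1, ((T ℝ q).eval x * (2 * Real.pi)⁻¹ -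
        (T ℝ (q + 2)).eval x * (2 * Real.pi)⁻¹) * Real.sqrt (1 - x ^ 2)⁻¹ = 0 := by
    rw [← integral_measureT, integral_sub, integral_mul_const, integral_mul_const,
      integral_eval_T_real_measureT_of_ne_zero (by exact_mod_cast hq),
      integral_eval_T_real_measureT_of_ne_zero (by omega)]
    · simp
    · exact integrable_measureT (by fun_prop)
    · exact integrable_measureT (by fun_prop)
  rw [h2, h3] at h1
  simpa using h1.symm

variable {A : Type*} [Ring A] [StarRing A] [Algebra ℂ A]

theorem IsSemicircular.apply_aeval {τ : A →ₗ[ℂ] ℂ} {a : A} (ha : IsSemicircular τ a) (p : ℝ[X]) :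
    τ (aeval a (p.map (algebraMap ℝ ℂ))) =
      ((∫ x in (-2 : ℝ)..2, p.eval x * (Real.sqrt (4 - x ^ 2) / (2 * Real.pi)) : ℝ) : ℂ) := by
  induction p using Polynomial.induction_on' with
  | add p q hp hq =>
    rw [Polynomial.map_add, map_add, map_add, hp, hq, ← Complex.ofReal_add,
      ← intervalIntegral.integral_add]
    · simp only [eval_add, add_mul]
    · exact Continuous.intervalIntegrable (by fun_prop) _ _
    · exact Continuous.intervalIntegrable (by fun_prop) _ _
  | monomial k c =>
    rw [map_monomial, aeval_monomial, ← Algebra.smul_def, map_smul, ha.2 k]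
    simp only [eval_monomial, mul_assoc, intervalIntegral.integral_const_mul, Complex.ofReal_mul]
    rfl

theorem IsSemicircular.apply_chebyshev {τ : A →ₗ[ℂ] ℂ} {a : A} (ha : IsSemicircular τ a) {q : ℕ}
    (hq : q ≠ 0) : τ (aeval a (S ℂ q)) = 0 := by
  have := ha.apply_aeval (S ℝ q)
  rwa [map_S, integral_semicircle_chebyshev_S hq, Complex.ofReal_zero] at this

variable {ι : Type*} [DecidableEq ι]

/-- The product, in reversed order, of Chebyshev polynomials in the letters of a word. -/
def chebyshevWord (a : ι → A) : List ι → A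
  | [] => 1
  | [i] => a i
  | i :: j :: v => chebyshevWord a (j :: v) * a i - if i = j then chebyshevWord a v else 0

/-- Within a run of equal letters the recursion of `chebyshevWord` is the three-term recursion of
the polynomials `S`. -/
theorem chebyshevWord_replicate (a : ι → A) (j : ι) (v : List ι) (hv : v.head? ≠ some j) :
    ∀ q : ℕ, chebyshevWord a (List.replicate q j ++ v) =
      chebyshevWord a v * aeval (a j) (S ℂ q)
  | 0 => by simp
  | 1 => by
    cases v with
    | nil => simp [chebyshevWord]
    | cons k v =>
      have : j ≠ k := by rintro rfl; simp at hv
      simp [chebyshevWord, this]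
  | q + 2 => by
    have h1 := chebyshevWord_replicate a j v hv (q + 1)
    have h0 := chebyshevWord_replicate a j v hv q
    rw [List.replicate_succ, List.cons_append] at h1
    rw [List.replicate_succ, List.replicate_succ, List.cons_append, List.cons_append,
      chebyshevWord, h1, h0, if_pos rfl]
    push_cast
    rw [S_add_two, mul_comm X, map_sub, map_mul, aeval_X]
    noncomm_ring

theorem exists_replicate_append (j : ι) (t : List ι) :
    ∃ q v, j :: t = List.replicate (q + 1) j ++ v ∧ v.head? ≠ some j := by
  induction t with
  | nil => exact ⟨0, [], rfl, by simp⟩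
  | cons k t ih =>
    by_cases hk : k = j
    · subst hk
      obtain ⟨q, v, h, hv⟩ := ih
      exact ⟨q + 1, v, by rw [h]; rfl, hv⟩
    · exact ⟨0, k :: t, rfl, by simpa using hk⟩

/-- Each maximal run of equal letters gives one centered Chebyshev factor, and consecutive runs have
different letters. The clause on `getLast?` keeps track of the letter next to which the following
factor is attached. -/
theorem IsFreeSemicircularFamily.exists_factorization {m : ℕ} {τ : A →ₗ[ℂ] ℂ} {a : Fin m → A}
    (ha : IsFreeSemicircularFamily τ a) : ∀ v : List (Fin m), v ≠ [] →
    ∃ l : List (Fin m × A), l ≠ [] ∧ l.IsChain (fun p q => p.1 ≠ q.1) ∧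
      (∀ p ∈ l, p.2 ∈ Algebra.adjoin ℂ {a p.1} ∧ τ p.2 = 0) ∧
      (l.map Prod.snd).prod = chebyshevWord a v ∧ ∀ x ∈ l.getLast?, v.head? = some x.1
  | [], h => absurd rfl h
  | j :: t, _ => by
    obtain ⟨q, v, h, hv⟩ := exists_replicate_append j t
    have hmem : aeval (a j) (S ℂ (q + 1 : ℕ)) ∈ Algebra.adjoin ℂ {a j} ∧
        τ (aeval (a j) (S ℂ (q + 1 : ℕ))) = 0 :=
      ⟨aeval_mem_adjoin_singleton _ _, (ha.1 j).apply_chebyshev (by omega)⟩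
    rw [h, chebyshevWord_replicate a j v hv]
    by_cases hv0 : v = []
    · subst hv0
      refine ⟨[(j, aeval (a j) (S ℂ (q + 1 : ℕ)))], by simp, by simp, ?_, ?_, ?_⟩
      · intro p hp
        obtain rfl := List.mem_singleton.1 hp
        exact hmem
      · simp [chebyshevWord]
      · simp [List.replicate_succ]
    · have hlt : v.length < (j :: t).length := by rw [h]; simp
      obtain ⟨l, hl0, hl1, hl2, hl3, hl4⟩ := exists_factorization ha v hv0
      refine ⟨l ++ [(j, aeval (a j) (S ℂ (q + 1 : ℕ)))], by simp, ?_, ?_, ?_, ?_⟩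
      · rw [List.isChain_append]
        refine ⟨hl1, by simp, fun x hx y hy => ?_⟩
        simp only [List.head?_cons, Option.mem_def, Option.some.injEq] at hy
        subst hy
        intro hxj
        exact hv (by rw [hl4 x hx, hxj])
      · intro p hp
        rcases List.mem_append.1 hp with hp | hp
        · exact hl2 p hp
        · obtain rfl := List.mem_singleton.1 hp
          exact hmem
      · simp [hl3]
      · simp [List.replicate_succ]
termination_by v => v.length
decreasing_by exact hlt

theorem IsFreeSemicircularFamily.apply_chebyshevWord {m : ℕ} {τ : A →ₗ[ℂ] ℂ} {a : Fin m → A}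
    (ha : IsFreeSemicircularFamily τ a) {v : List (Fin m)} (hv : v ≠ []) :
    τ (chebyshevWord a v) = 0 := by
  obtain ⟨l, h0, h1, h2, h3, -⟩ := ha.exists_factorization v hv
  rw [← h3]
  exact ha.2 l h0 h1 h2

/-- Right multiplication of a Chebyshev word by `a i` either prepends `i` or, when `i` is the first
letter, also removes it: the same recursion as `fockCoeff`. With no letters left to absorb, freeness
kills every nonempty Chebyshev word. -/
theorem IsFreeSemicircularFamily.apply_chebyshevWord_mul_prod {m : ℕ} {τ : A →ₗ[ℂ] ℂ}
    (hτ : τ 1 = 1) {a : Fin m → A} (ha : IsFreeSemicircularFamily τ a) (w v : List (Fin m)) :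
    τ (chebyshevWord a v * (w.map a).prod) = fockCoeff w v := by
  induction w generalizing v with
  | nil =>
    rw [List.map_nil, List.prod_nil, mul_one, fockCoeff]
    split_ifs with hv
    · rw [hv, chebyshevWord, hτ, Complex.ofReal_one]
    · rw [ha.apply_chebyshevWord hv, Complex.ofReal_zero]
  | cons i w ih =>
    cases v with
    | nil => rw [fockCoeff, ← ih, List.map_cons, List.prod_cons, chebyshevWord, chebyshevWord,
        one_mul]
    | cons k v =>
      have h1 := ih (i :: k :: v)
      rw [chebyshevWord, sub_mul, map_sub, mul_assoc, sub_eq_iff_eq_add] at h1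
      rw [fockCoeff, List.map_cons, List.prod_cons, h1, Complex.ofReal_add]
      split_ifs with hik
      · rw [ih]
      · simp

theorem IsFreeSemicircularFamily.apply_prod {m : ℕ} {τ : A →ₗ[ℂ] ℂ} (hτ : τ 1 = 1)
    {a : Fin m → A} (ha : IsFreeSemicircularFamily τ a) (w : List (Fin m)) :
    τ (w.map a).prod = fockCoeff w [] := by
  rw [← ha.apply_chebyshevWord_mul_prod hτ, chebyshevWord, one_mul]

end Semicircle

/-! ### Moments of the entries -/

section Subgaussian

/-- The summands of a bound on the `q`-th absolute moment of a variable with tails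
`K exp (-κ t²)`. -/
noncomputable def tailTerm (K κ : ℝ) (q j : ℕ) : ℝ :=
  (if j = 0 then 1 else 0) +
    K * Real.exp κ * (((j + 1 : ℕ) : ℝ) ^ q * Real.exp (-κ * ((j + 1 : ℕ) : ℝ)))

theorem tailTerm_nonneg {K κ : ℝ} (hK : 0 < K) (q j : ℕ) : 0 ≤ tailTerm K κ q j := by
  unfold tailTerm
  have : (0 : ℝ) ≤ if j = 0 then 1 else 0 := by split_ifs <;> norm_num
  positivity

theorem summable_tailTerm {K κ : ℝ} (hκ : 0 < κ) (q : ℕ) : Summable (tailTerm K κ q) := by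
  refine Summable.add (summable_of_ne_finset_zero (s := {0}) fun j hj => ?_)
    (Summable.mul_left _ ?_)
  · rw [if_neg (by simpa using hj)]
  · exact (summable_nat_add_iff 1).2 (Real.summable_pow_mul_exp_neg_nat_mul q hκ)

/-- A bound on the `q`-th absolute moment of a variable with tails `K exp (-κ t²)`. -/
noncomputable def tailBound (K κ : ℝ) (q : ℕ) : ℝ := ∑' j, tailTerm K κ q j

theorem tailBound_nonneg {K κ : ℝ} (hK : 0 < K) (q : ℕ) : 0 ≤ tailBound K κ q :=
  tsum_nonneg fun j => tailTerm_nonneg hK q j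

variable {Ω : Type*} [MeasurableSpace Ω] {P : Measure Ω} [IsProbabilityMeasure P]

theorem lintegral_abs_pow_le_tailBound {K κ : ℝ} (hK : 0 < K) (hκ : 0 < κ) {Z : Ω → ℝ}
    (hZ : Measurable Z)
    (htail : ∀ t : ℝ, 0 < t → P.real {ω | t ≤ |Z ω|} ≤ K * Real.exp (-κ * t ^ 2)) (q : ℕ) :
    ∫⁻ ω, ENNReal.ofReal (|Z ω| ^ q) ∂P ≤ ENNReal.ofReal (tailBound K κ q) := by
  have hmeas : ∀ j : ℕ, MeasurableSet {ω | (j : ℝ) ≤ |Z ω|} := fun j =>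
    measurableSet_le measurable_const hZ.abs
  -- The term with `j` the integer part of `|Z ω|` alone dominates the left side.
  have h1 : ∀ ω, ENNReal.ofReal (|Z ω| ^ q) ≤
      ∑' j : ℕ, Set.indicator {ω | (j : ℝ) ≤ |Z ω|}
        (fun _ => ENNReal.ofReal (((j + 1 : ℕ) : ℝ) ^ q)) ω := by
    intro ω
    refine le_trans ?_ (ENNReal.le_tsum ⌊|Z ω|⌋₊)
    rw [Set.indicator_of_mem (by simpa using Nat.floor_le (abs_nonneg _))]
    refine ENNReal.ofReal_le_ofReal (pow_le_pow_left₀ (abs_nonneg _) ?_ q)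
    push_cast
    exact (Nat.lt_floor_add_one _).le
  refine (lintegral_mono h1).trans ?_
  rw [lintegral_tsum fun j => (measurable_const.indicator (hmeas j)).aemeasurable, tailBound,
    ENNReal.ofReal_tsum_of_nonneg (tailTerm_nonneg hK q) (summable_tailTerm hκ q)]
  refine ENNReal.tsum_le_tsum fun j => ?_
  rw [lintegral_indicator_const (hmeas j), ← ofReal_measureReal, ← ENNReal.ofReal_mul (by positivity)]
  refine ENNReal.ofReal_le_ofReal ?_
  unfold tailTerm
  rcases Nat.eq_zero_or_pos j with rfl | hj
  · have : 0 ≤ K * Real.exp κ * (((0 + 1 : ℕ) : ℝ) ^ q * Real.exp (-κ * ((0 + 1 : ℕ) : ℝ))) := by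
      positivity
    have h2 : P.real {ω | ((0 : ℕ) : ℝ) ≤ |Z ω|} ≤ 1 := measureReal_le_one
    rw [if_pos rfl]
    simp only [zero_add, Nat.cast_one, one_pow, one_mul] at *
    linarith
  · rw [if_neg hj.ne', zero_add]
    have hj1 : (1 : ℝ) ≤ j := by exact_mod_cast hj
    have h2 := htail j (by linarith)
    -- Since `j² ≥ j = (j + 1) - 1`, the Gaussian tail is dominated by a geometric one.
    have h3 : Real.exp (-κ * (j : ℝ) ^ 2) ≤ Real.exp κ * Real.exp (-κ * ((j + 1 : ℕ) : ℝ)) := by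
      rw [← Real.exp_add]
      refine Real.exp_le_exp.2 ?_
      push_cast
      nlinarith [mul_nonneg hκ.le (mul_nonneg (by linarith : (0 : ℝ) ≤ j) (sub_nonneg.2 hj1))]
    calc _ ≤ ((j + 1 : ℕ) : ℝ) ^ q *
          (K * (Real.exp κ * Real.exp (-κ * ((j + 1 : ℕ) : ℝ)))) := by
          gcongr
          exact h2.trans (by gcongr)
      _ = _ := by ring

theorem integrable_abs_pow_of_tail {K κ : ℝ} (hK : 0 < K) (hκ : 0 < κ) {Z : Ω → ℝ}
    (hZ : Measurable Z)
    (htail : ∀ t : ℝ, 0 < t → P.real {ω | t ≤ |Z ω|} ≤ K * Real.exp (-κ * t ^ 2)) (q : ℕ) :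
    Integrable (fun ω => |Z ω| ^ q) P := by
  refine ⟨(hZ.abs.pow_const q).aestronglyMeasurable, ?_⟩
  rw [hasFiniteIntegral_iff_ofReal (Eventually.of_forall fun ω => by positivity)]
  exact (lintegral_abs_pow_le_tailBound hK hκ hZ htail q).trans_lt ENNReal.ofReal_lt_top

theorem integral_abs_pow_le_tailBound {K κ : ℝ} (hK : 0 < K) (hκ : 0 < κ) {Z : Ω → ℝ}
    (hZ : Measurable Z)
    (htail : ∀ t : ℝ, 0 < t → P.real {ω | t ≤ |Z ω|} ≤ K * Real.exp (-κ * t ^ 2)) (q : ℕ) :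
    ∫ ω, |Z ω| ^ q ∂P ≤ tailBound K κ q := by
  rw [integral_eq_lintegral_of_nonneg_ae (Eventually.of_forall fun ω => by positivity)
    (hZ.abs.pow_const q).aestronglyMeasurable]
  exact ENNReal.toReal_le_of_le_ofReal (tailBound_nonneg hK q)
    (lintegral_abs_pow_le_tailBound hK hκ hZ htail q)

/-- A bound on the `q`-th absolute moment of a centered variable whose tails about some point are
bounded by `K exp (-κ t²)`. -/
noncomputable def momentBound (K κ : ℝ) (q : ℕ) : ℝ :=
  ∑ i ∈ Finset.range (q + 1), (1 + 2 ^ i * (tailBound K κ i + tailBound K κ 1 ^ i))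

theorem momentBound_mono {K κ : ℝ} (hK : 0 < K) : Monotone (momentBound K κ) := by
  intro a b hab
  refine Finset.sum_le_sum_of_subset_of_nonneg (Finset.range_mono (by omega)) fun i _ _ => ?_
  have h1 := tailBound_nonneg (κ := κ) hK i
  have h2 := tailBound_nonneg (κ := κ) hK 1
  positivity

theorem le_momentBound {K κ : ℝ} (hK : 0 < K) (q : ℕ) :
    1 + 2 ^ q * (tailBound K κ q + tailBound K κ 1 ^ q) ≤ momentBound K κ q := by
  refine Finset.single_le_sum (f := fun i => 1 + 2 ^ i * (tailBound K κ i + tailBound K κ 1 ^ i))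
    (fun i _ => ?_) (Finset.self_mem_range_succ q)
  have h1 := tailBound_nonneg (κ := κ) hK i
  have h2 := tailBound_nonneg (κ := κ) hK 1
  positivity

theorem one_le_momentBound {K κ : ℝ} (hK : 0 < K) (q : ℕ) : 1 ≤ momentBound K κ q := by
  have h1 := tailBound_nonneg (κ := κ) hK q
  have h2 := tailBound_nonneg (κ := κ) hK 1
  refine le_trans ?_ (le_momentBound hK q)
  have : 0 ≤ 2 ^ q * (tailBound K κ q + tailBound K κ 1 ^ q) := by positivity
  linarith

theorem abs_pow_le_two_pow_mul (x y : ℝ) (q : ℕ) : |x + y| ^ q ≤ 2 ^ q * (|x| ^ q + |y| ^ q) := by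
  calc |x + y| ^ q ≤ (2 * max |x| |y|) ^ q := by
        gcongr
        refine (abs_add_le x y).trans ?_
        rw [two_mul]
        exact add_le_add (le_max_left _ _) (le_max_right _ _)
    _ = 2 ^ q * max |x| |y| ^ q := mul_pow _ _ _
    _ ≤ 2 ^ q * (|x| ^ q + |y| ^ q) := by
        gcongr
        rcases max_cases |x| |y| with ⟨h, -⟩ | ⟨h, -⟩ <;> rw [h]
        · linarith [pow_nonneg (abs_nonneg y) q]
        · linarith [pow_nonneg (abs_nonneg x) q]

theorem moments_of_tail {K κ : ℝ} (hK : 0 < K) (hκ : 0 < κ) {Y : Ω → ℝ} (hY : Measurable Y)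
    (hY0 : ∫ ω, Y ω ∂P = 0) {M : ℝ}
    (htail : ∀ t : ℝ, 0 < t → P.real {ω | t ≤ |Y ω - M|} ≤ K * Real.exp (-κ * t ^ 2)) (q : ℕ) :
    Integrable (fun ω => |Y ω| ^ q) P ∧ ∫ ω, |Y ω| ^ q ∂P ≤ momentBound K κ q := by
  have hZ : Measurable fun ω => Y ω - M := hY.sub_const M
  have hi := integrable_abs_pow_of_tail hK hκ hZ htail
  have hb := integral_abs_pow_le_tailBound hK hκ hZ htail
  -- As `Y` is centered, `-M` is the mean of `Y - M`, so the median is controlled by the first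
  -- absolute moment about it.
  have hM : |M| ≤ tailBound K κ 1 := by
    have hi1 : Integrable (fun ω => Y ω - M) P := by
      have := hi 1
      simp only [pow_one] at this
      exact (integrable_norm_iff hZ.aestronglyMeasurable).1 this
    have hYi : Integrable Y P := by
      refine (hi1.add (integrable_const M)).congr (Eventually.of_forall fun ω => ?_)
      simp
    have h0 : ∫ ω, (Y ω - M) ∂P = -M := by
      rw [integral_sub hYi (integrable_const M), hY0]
      simp
    have := abs_integral_le_integral_abs (f := fun ω => Y ω - M) (μ := P)
    rw [h0, abs_neg] at this
    refine this.trans ?_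
    simpa using hb 1
  have hpt : ∀ ω, |Y ω| ^ q ≤ 2 ^ q * (|Y ω - M| ^ q + |M| ^ q) := fun ω => by
    simpa using abs_pow_le_two_pow_mul (Y ω - M) M q
  have hdom : Integrable (fun ω => 2 ^ q * (|Y ω - M| ^ q + |M| ^ q)) P :=
    ((hi q).add (integrable_const _)).const_mul _
  have hint : Integrable (fun ω => |Y ω| ^ q) P := by
    refine hdom.mono' (hY.abs.pow_const q).aestronglyMeasurable (Eventually.of_forall fun ω => ?_)
    rw [Real.norm_of_nonneg (by positivity)]
    exact hpt ω
  refine ⟨hint, (integral_mono hint hdom hpt).trans ?_⟩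
  rw [integral_const_mul, integral_add (hi q) (integrable_const _)]
  simp only [integral_const, probReal_univ, smul_eq_mul, one_mul]
  have h2 := le_momentBound (κ := κ) hK q
  have h3 : |M| ^ q ≤ tailBound K κ 1 ^ q := pow_le_pow_left₀ (abs_nonneg _) hM q
  have h4 : (2 : ℝ) ^ q * (∫ ω, |Y ω - M| ^ q ∂P + |M| ^ q) ≤
      2 ^ q * (tailBound K κ q + tailBound K κ 1 ^ q) :=
    mul_le_mul_of_nonneg_left (add_le_add (hb q) h3) (by positivity)
  linarith

end Subgaussian

/-! ### Concentration of single entries -/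

section HilbertSchmidtEntry

attribute [local instance] Matrix.frobeniusNormedAddCommGroup Matrix.frobeniusNormedSpace

theorem abs_re_entry_le_frobenius {n : ℕ} (A : Matrix (Fin n) (Fin n) ℂ) (i k : Fin n) :
    |(A i k).re| ≤ ‖A‖ := by
  refine (Complex.abs_re_le_norm _).trans ?_
  rw [Matrix.frobenius_norm_def, ← Real.sqrt_eq_rpow]
  refine Real.le_sqrt_of_sq_le ?_
  have h1 : ‖A i k‖ ^ (2 : ℝ) ≤ ∑ k', ‖A i k'‖ ^ (2 : ℝ) :=
    Finset.single_le_sum (f := fun k' => ‖A i k'‖ ^ (2 : ℝ)) (fun _ _ => by positivity)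
      (Finset.mem_univ k)
  have h2 : ∑ k', ‖A i k'‖ ^ (2 : ℝ) ≤ ∑ i', ∑ k', ‖A i' k'‖ ^ (2 : ℝ) :=
    Finset.single_le_sum (f := fun i' => ∑ k', ‖A i' k'‖ ^ (2 : ℝ))
      (fun _ _ => Finset.sum_nonneg fun _ _ => by positivity) (Finset.mem_univ i)
  rw [← Real.rpow_natCast]
  exact_mod_cast h1.trans h2

theorem MatrixConvexConcentration.exists_tail_entry {Ω : Type*} [MeasurableSpace Ω]
    {P : Measure Ω} {n : ℕ} {X : Ω → Matrix (Fin n) (Fin n) ℂ} {K κ : ℝ}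
    (h : MatrixConvexConcentration P X K κ) (i k : Fin n) :
    ∃ M : ℝ, ∀ t : ℝ, 0 < t →
      P.real {ω | t ≤ |(X ω i k).re - M|} ≤ K * Real.exp (-κ * t ^ 2) := by
  obtain ⟨M, -, hM⟩ := h (fun A => (A i k).re)
    ⟨convex_univ, fun A _ B _ a b _ _ _ => by simp⟩
    (LipschitzWith.of_dist_le_mul fun A B => by
      rw [NNReal.coe_one, one_mul, Real.dist_eq, dist_eq_norm]
      simpa using abs_re_entry_le_frobenius (A - B) i k)
  exact ⟨M, hM⟩

end HilbertSchmidtEntry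

/-! ### The independent off-diagonal entries -/

section EntryVar

variable {Ω : Type*} {m n : ℕ}

/-- The entries above the diagonal, indexed by coloured edges and set to zero on loops. -/
noncomputable def entryVar (X : Fin m → Ω → Matrix (Fin n) (Fin n) ℂ) (c : Fin m × Sym2 (Fin n))
    (ω : Ω) : ℝ :=
  if c.2.IsDiag then 0 else (X c.1 ω c.2.inf c.2.sup).re

theorem inf_lt_sup_of_not_isDiag {c : Sym2 (Fin n)} (hc : ¬ c.IsDiag) : c.inf < c.sup := by
  induction c with
  | h a b =>
    rw [Sym2.mk_isDiag_iff] at hc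
    simpa [eq_comm] using hc

theorem inf_sup_injective {c d : Sym2 (Fin n)} (h1 : c.inf = d.inf) (h2 : c.sup = d.sup) :
    c = d := Sym2.inf_eq_inf_and_sup_eq_sup.1 ⟨h1, h2⟩

variable [MeasurableSpace Ω] {P : Measure Ω} [IsProbabilityMeasure P]

/-- The hypotheses on a family of random matrices of a fixed size. -/
structure IsWignerFamily (P : Measure Ω) (X : Fin m → Ω → Matrix (Fin n) (Fin n) ℂ)
    (K κ : ℝ) : Prop where
  meas : ∀ j i k, Measurable fun ω => X j ω i k
  indep : iIndepFun (β := fun _ => Fin n → Fin n → ℂ) (fun j ω i k => X j ω i k) P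
  centered : ∀ j i k, ∫ ω, X j ω i k ∂P = 0
  posK : 0 < K
  posκ : 0 < κ
  ccp : ∀ j, MatrixConvexConcentration P (X j) K κ
  real : ∀ j, ∀ᵐ ω ∂P, ∀ i k, (X j ω i k).im = 0
  symm : ∀ j, ∀ᵐ ω ∂P, (X j ω).IsSymm
  entries : ∀ j, iIndepFun
      (fun (e : {e : Fin n × Fin n // e.1 < e.2}) ω => X j ω e.1.1 e.1.2) P
  var : ∀ j, ∀ i k : Fin n, i < k → Var[fun ω => (X j ω i k).re; P] = 1

variable {X : Fin m → Ω → Matrix (Fin n) (Fin n) ℂ} {K κ : ℝ}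

theorem IsWignerFamily.measurable_re (h : IsWignerFamily P X K κ) (j : Fin m) (i k : Fin n) :
    Measurable fun ω => (X j ω i k).re := Complex.measurable_re.comp (h.meas j i k)

theorem IsWignerFamily.integral_re (h : IsWignerFamily P X K κ) (j : Fin m) (i k : Fin n) :
    ∫ ω, (X j ω i k).re ∂P = 0 := by
  have h1 : ∫ ω, (((X j ω i k).re : ℝ) : ℂ) ∂P = 0 := by
    rw [← h.centered j i k]
    refine integral_congr_ae ?_
    filter_upwards [h.real j] with ω hω
    exact Complex.ext rfl (by simp [hω i k])
  have h2 : ((∫ ω, (X j ω i k).re ∂P : ℝ) : ℂ) = 0 := integral_ofReal.symm.trans h1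
  exact_mod_cast h2

theorem IsWignerFamily.moments_re (h : IsWignerFamily P X K κ) (j : Fin m) (i k : Fin n) (q : ℕ) :
    Integrable (fun ω => |(X j ω i k).re| ^ q) P ∧
      ∫ ω, |(X j ω i k).re| ^ q ∂P ≤ momentBound K κ q := by
  obtain ⟨M, hM⟩ := (h.ccp j).exists_tail_entry i k
  exact moments_of_tail h.posK h.posκ (h.measurable_re j i k) (h.integral_re j i k) hM q

theorem IsWignerFamily.measurable_entryVar (h : IsWignerFamily P X K κ)
    (c : Fin m × Sym2 (Fin n)) : Measurable (entryVar X c) := by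
  unfold entryVar
  by_cases hc : c.2.IsDiag
  · simp only [hc, if_true]; exact measurable_const
  · simp only [hc, if_false]; exact h.measurable_re _ _ _

theorem IsWignerFamily.moments_entryVar (h : IsWignerFamily P X K κ)
    (c : Fin m × Sym2 (Fin n)) (q : ℕ) :
    Integrable (fun ω => |entryVar X c ω| ^ q) P ∧
      ∫ ω, |entryVar X c ω| ^ q ∂P ≤ momentBound K κ q := by
  unfold entryVar
  by_cases hc : c.2.IsDiag
  · simp only [hc, if_true]
    refine ⟨integrable_const _, ?_⟩
    have := one_le_momentBound (κ := κ) h.posK q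
    rcases Nat.eq_zero_or_pos q with rfl | hq
    · simpa using this
    · simp [hq.ne']; linarith
  · simp only [hc, if_false]; exact h.moments_re _ _ _ q

/-- The moments of the entries. -/
noncomputable def entryMoment (P : Measure Ω) (X : Fin m → Ω → Matrix (Fin n) (Fin n) ℂ)
    (c : Fin m × Sym2 (Fin n)) (q : ℕ) : ℝ := ∫ ω, entryVar X c ω ^ q ∂P

theorem IsWignerFamily.isEdgeMoment (h : IsWignerFamily P X K κ) :
    IsEdgeMoment (entryMoment P X) (momentBound K κ) where
  zero c := by simp [entryMoment]
  one c := by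
    unfold entryMoment entryVar
    by_cases hc : c.2.IsDiag
    · simp [hc]
    · simp only [hc, if_false, pow_one]; exact h.integral_re _ _ _
  two c hc := by
    unfold entryMoment entryVar
    simp only [hc, if_false]
    rw [← h.var c.1 _ _ (inf_lt_sup_of_not_isDiag hc),
      variance_eq_integral (h.measurable_re _ _ _).aemeasurable, h.integral_re]
    simp
  diag c hc k hk := by simp [entryMoment, entryVar, hc, hk]
  mono := momentBound_mono h.posK
  one_le := one_le_momentBound h.posK
  abs_le c k := by
    refine abs_integral_le_integral_abs.trans ?_
    simp only [abs_pow]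
    exact (h.moments_entryVar c k).2

/-- Independence of the matrices and independence within each upper triangle combine; `inf` and
`sup` identify a non-loop edge with a position above the diagonal. -/
theorem IsWignerFamily.iIndepFun_entryVar (h : IsWignerFamily P X K κ) :
    iIndepFun (fun (c : {c : Fin m × Sym2 (Fin n) // ¬ c.2.IsDiag}) ω => entryVar X c.1 ω) P := by
  have h1 : iIndepFun (fun (j : Fin m) ω (e : {e : Fin n × Fin n // e.1 < e.2}) =>
      X j ω e.1.1 e.1.2) P :=
    h.indep.comp (fun _ (A : Fin n → Fin n → ℂ) (e : {e : Fin n × Fin n // e.1 < e.2}) =>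
      A e.1.1 e.1.2) fun _ => by fun_prop
  have h2 := iIndepFun_uncurry' (X := fun (j : Fin m)
    (e : {e : Fin n × Fin n // e.1 < e.2}) ω => X j ω e.1.1 e.1.2)
    (fun j e => h.meas j _ _) h1 h.entries
  have h3 := h2.precomp (g := fun c : {c : Fin m × Sym2 (Fin n) // ¬ c.2.IsDiag} =>
    (c.1.1, (⟨(c.1.2.inf, c.1.2.sup), inf_lt_sup_of_not_isDiag c.2⟩ :
      {e : Fin n × Fin n // e.1 < e.2}))) (by
    rintro ⟨⟨i, c⟩, hc⟩ ⟨⟨j, d⟩, hd⟩ he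
    simp only [Prod.mk.injEq, Subtype.mk.injEq] at he
    obtain ⟨rfl, h1, h2⟩ := he
    obtain rfl := inf_sup_injective h1 h2
    rfl)
  have h4 := h3.comp (fun _ => Complex.re) fun _ => Complex.measurable_re
  convert h4 using 1
  funext c ω
  simp [entryVar, c.2]

theorem IsWignerFamily.integral_prod_entryVar (h : IsWignerFamily P X K κ)
    (L : List (Fin m × Sym2 (Fin n))) :
    ∫ ω, (L.map fun c => entryVar X c ω).prod ∂P = mixedMoment (entryMoment P X) L := by
  have hprod : ∀ ω, (L.map fun c => entryVar X c ω).prod = ∏ c, entryVar X c ω ^ L.count c := by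
    intro ω
    rw [Finset.prod_list_map_count]
    refine Finset.prod_subset (Finset.subset_univ _) fun c _ hc => ?_
    rw [List.count_eq_zero_of_not_mem (by simpa using hc), pow_zero]
  simp only [hprod]
  -- A loop makes both sides zero; without loops only the independent off-diagonal variables remain.
  by_cases hL : ∃ c ∈ L, c.2.IsDiag
  · obtain ⟨c, hcL, hc⟩ := hL
    have hcount : L.count c ≠ 0 := (List.count_pos_iff.2 hcL).ne'
    rw [mixedMoment, Finset.prod_eq_zero (Finset.mem_univ c) (h.isEdgeMoment.diag c hc _ hcount)]
    have : ∀ ω, ∏ c, entryVar X c ω ^ L.count c = 0 := fun ω =>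
      Finset.prod_eq_zero (Finset.mem_univ c) (by simp [entryVar, hc, hcount])
    simp [this]
  · push Not at hL
    have hz : ∀ c : {c : Fin m × Sym2 (Fin n) // ¬ ¬ c.2.IsDiag}, L.count c.1 = 0 := fun c =>
      List.count_eq_zero_of_not_mem fun hc => c.2 (hL _ hc)
    have hsub : ∀ f : Fin m × Sym2 (Fin n) → ℕ → ℝ, (∀ c, f c 0 = 1) →
        ∏ c, f c (L.count c) =
          ∏ c : {c : Fin m × Sym2 (Fin n) // ¬ c.2.IsDiag}, f c.1 (L.count c.1) := by
      intro f hf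
      rw [← Fintype.prod_subtype_mul_prod_subtype (fun c : Fin m × Sym2 (Fin n) => ¬ c.2.IsDiag)]
      rw [Finset.prod_eq_one (s := (Finset.univ : Finset {c : Fin m × Sym2 (Fin n) //
        ¬ ¬ c.2.IsDiag})) fun c _ => by rw [hz c, hf], mul_one]
    rw [mixedMoment, hsub _ h.isEdgeMoment.zero]
    have : ∀ ω, ∏ c, entryVar X c ω ^ L.count c =
        ∏ c : {c : Fin m × Sym2 (Fin n) // ¬ c.2.IsDiag}, entryVar X c.1 ω ^ L.count c.1 :=
      fun ω => hsub (fun c k => entryVar X c ω ^ k) fun c => pow_zero _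
    simp only [this]
    exact h.iIndepFun_entryVar.integral_fun_prod_comp
      (f := fun c x => x ^ L.count c.1)
      (fun c => (h.measurable_entryVar c.1).aemeasurable) fun c => by fun_prop

theorem IsWignerFamily.memLp_entryVar (h : IsWignerFamily P X K κ) (c : Fin m × Sym2 (Fin n))
    (q : ℕ) : MemLp (entryVar X c) q P := by
  rcases Nat.eq_zero_or_pos q with rfl | hq
  · simpa using (h.measurable_entryVar c).aestronglyMeasurable
  · rw [← integrable_norm_rpow_iff (h.measurable_entryVar c).aestronglyMeasurable
      (by exact_mod_cast hq.ne') (by simp)]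
    simpa using (h.moments_entryVar c q).1

theorem IsWignerFamily.memLp_prod (h : IsWignerFamily P X K κ)
    (L : List (Fin m × Sym2 (Fin n))) (q : ℕ) :
    MemLp (fun ω => (L.map fun c => entryVar X c ω).prod) q P := by
  induction L generalizing q with
  | nil => simpa using memLp_const (1 : ℝ)
  | cons c L ih =>
    simp only [List.map_cons, List.prod_cons]
    have : ENNReal.HolderTriple ((2 * q : ℕ) : ENNReal) ((2 * q : ℕ) : ENNReal) (q : ENNReal) :=
      ⟨by
        push_cast
        rw [ENNReal.mul_inv (by simp) (by simp), ← add_mul, ENNReal.inv_two_add_inv_two, one_mul]⟩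
    exact (ih (2 * q)).mul' (h.memLp_entryVar c (2 * q))

/-- The trace of a word in the matrices of off-diagonal entries. -/
noncomputable def wordTrace (X : Fin m → Ω → Matrix (Fin n) (Fin n) ℂ) (w : List (Fin m)) (ω : Ω) :
    ℝ :=
  ((w.map (edgeMatrix fun c => entryVar X c ω)).prod).trace

theorem wordTrace_eq_sum (w : List (Fin m)) (ω : Ω) :
    wordTrace X w ω = ∑ p, ∑ L ∈ walks w p p,
      ((L.map stepEdge).map fun c => entryVar X c ω).prod := by
  simp only [wordTrace, Matrix.trace, Matrix.diag_apply, prod_edgeMatrix_apply]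

theorem IsWignerFamily.memLp_wordTrace (h : IsWignerFamily P X K κ) (w : List (Fin m)) (q : ℕ) :
    MemLp (wordTrace X w) q P := by
  have : wordTrace X w = fun ω => ∑ p, ∑ L ∈ walks w p p,
      ((L.map stepEdge).map fun c => entryVar X c ω).prod := funext (wordTrace_eq_sum w)
  rw [this]
  exact memLp_finsetSum _ fun p _ => memLp_finsetSum _ fun L _ => h.memLp_prod _ q

theorem IsWignerFamily.integrable_prod (h : IsWignerFamily P X K κ)
    (L : List (Fin m × Sym2 (Fin n))) :
    Integrable (fun ω => (L.map fun c => entryVar X c ω).prod) P := by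
  have := h.memLp_prod L 1
  rw [Nat.cast_one] at this
  exact memLp_one_iff_integrable.1 this

theorem IsWignerFamily.integral_wordTrace (h : IsWignerFamily P X K κ) (w : List (Fin m)) :
    ∫ ω, wordTrace X w ω ∂P = traceMoment (entryMoment P X) w := by
  simp only [wordTrace_eq_sum, traceMoment]
  rw [integral_finsetSum _ fun p _ => integrable_finsetSum _ fun L _ => h.integrable_prod _]
  refine Finset.sum_congr rfl fun p _ => ?_
  rw [integral_finsetSum _ fun L _ => h.integrable_prod _]
  exact Finset.sum_congr rfl fun L _ => h.integral_prod_entryVar _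

theorem IsWignerFamily.integral_wordTrace_mul (h : IsWignerFamily P X K κ) (u z : List (Fin m)) :
    ∫ ω, wordTrace X u ω * wordTrace X z ω ∂P = traceMoment₂ (entryMoment P X) u z := by
  simp only [wordTrace_eq_sum, traceMoment₂, Finset.sum_mul_sum, ← List.prod_append,
    ← List.map_append]
  rw [integral_finsetSum _ fun p _ => integrable_finsetSum _ fun q _ =>
    integrable_finsetSum _ fun L _ => integrable_finsetSum _ fun L' _ => h.integrable_prod _]
  refine Finset.sum_congr rfl fun p _ => ?_
  rw [integral_finsetSum _ fun q _ =>
    integrable_finsetSum _ fun L _ => integrable_finsetSum _ fun L' _ => h.integrable_prod _]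
  refine Finset.sum_congr rfl fun q _ => ?_
  rw [integral_finsetSum _ fun L _ => integrable_finsetSum _ fun L' _ => h.integrable_prod _]
  refine Finset.sum_congr rfl fun L _ => ?_
  rw [integral_finsetSum _ fun L' _ => h.integrable_prod _]
  exact Finset.sum_congr rfl fun L' _ => by rw [h.integral_prod_entryVar, List.map_append]

end EntryVar

/-! ### Convergence of normalized traces of words -/

section AlmostSure

variable {Ω : Type*} [MeasurableSpace Ω] {P : Measure Ω}

/-- The sum of the `g n` has finite expectation, hence is almost surely finite and its terms tend to
zero. No relation between different `n` is needed. -/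
theorem ae_tendsto_zero_of_summable_integral {g : ℕ → Ω → ℝ} {b : ℕ → ℝ}
    (hg0 : ∀ n ω, 0 ≤ g n ω) (hg : ∀ n, Integrable (g n) P) (hb : ∀ n, ∫ ω, g n ω ∂P ≤ b n)
    (hs : Summable b) : ∀ᵐ ω ∂P, Tendsto (fun n => g n ω) atTop (𝓝 0) := by
  have hmeas : ∀ n, AEMeasurable (fun ω => ENNReal.ofReal (g n ω)) P := fun n =>
    (hg n).aestronglyMeasurable.aemeasurable.ennreal_ofReal
  have hb0 : ∀ n, 0 ≤ b n := fun n => (integral_nonneg (hg0 n)).trans (hb n)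
  have h1 : ∫⁻ ω, ∑' n, ENNReal.ofReal (g n ω) ∂P ≠ ⊤ := by
    rw [lintegral_tsum hmeas]
    refine ne_top_of_le_ne_top (ENNReal.ofReal_ne_top (r := ∑' n, b n)) ?_
    rw [ENNReal.ofReal_tsum_of_nonneg hb0 hs]
    refine ENNReal.tsum_le_tsum fun n => ?_
    rw [← ofReal_integral_eq_lintegral_ofReal (hg n) (Eventually.of_forall (hg0 n))]
    exact ENNReal.ofReal_le_ofReal (hb n)
  filter_upwards [ae_lt_top' (AEMeasurable.tsum hmeas) h1] with ω hω
  have h2 := ENNReal.tendsto_atTop_zero_of_tsum_ne_top hω.ne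
  have h3 := (ENNReal.tendsto_toReal ENNReal.zero_ne_top).comp h2
  refine h3.congr fun n => ?_
  simp [ENNReal.toReal_ofReal (hg0 n ω)]

end AlmostSure

/-! ### Convergence in mean and almost surely, without the diagonal -/

section Limit

variable {Ω : Type*} [MeasurableSpace Ω] {P : Measure Ω} [IsProbabilityMeasure P] {m : ℕ}
  {X : (n : ℕ) → Fin m → Ω → Matrix (Fin n) (Fin n) ℂ} {K κ : ℝ}

/-- The expected normalized trace of a word. -/
noncomputable def meanTrace (P : Measure Ω) (X : (n : ℕ) → Fin m → Ω → Matrix (Fin n) (Fin n) ℂ)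
    (w : List (Fin m)) (n : ℕ) : ℝ :=
  traceMoment (entryMoment P (X n)) w / Real.sqrt n ^ (w.length + 2)

/-- The expected product of the normalized traces of two words. -/
noncomputable def meanTrace₂ (P : Measure Ω) (X : (n : ℕ) → Fin m → Ω → Matrix (Fin n) (Fin n) ℂ)
    (u z : List (Fin m)) (n : ℕ) : ℝ :=
  traceMoment₂ (entryMoment P (X n)) u z / Real.sqrt n ^ (u.length + z.length + 4)

/-- The normalized trace of a word. -/
noncomputable def normTrace (X : (n : ℕ) → Fin m → Ω → Matrix (Fin n) (Fin n) ℂ)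
    (w : List (Fin m)) (n : ℕ) (ω : Ω) : ℝ :=
  wordTrace (X n) w ω / Real.sqrt n ^ (w.length + 2)

theorem exists_abs_meanTrace₂_sub_le (h : ∀ n, IsWignerFamily P (X n) K κ) (u z : List (Fin m)) :
    ∃ C : ℝ, ∀ n : ℕ, 1 ≤ n →
      |meanTrace₂ P X u z n - meanTrace P X u n * meanTrace P X z n| ≤
        C * (Real.sqrt n ^ 3)⁻¹ := by
  refine ⟨2 * (momentBound K κ (u.length + z.length) ^ (u.length + z.length)) ^ 2 *
    (((u.length + z.length + 1) / 2 : ℕ) : ℝ) ^ (u.length + z.length + 2), fun n hn => ?_⟩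
  have : Nonempty (Fin n) := ⟨⟨0, hn⟩⟩
  have key := (h n).isEdgeMoment.abs_traceMoment₂_sub_le u z
  rw [Fintype.card_fin] at key
  have hs : 0 < Real.sqrt n := Real.sqrt_pos.2 (by exact_mod_cast hn)
  have e : meanTrace₂ P X u z n - meanTrace P X u n * meanTrace P X z n =
      (traceMoment₂ (entryMoment P (X n)) u z - traceMoment (entryMoment P (X n)) u *
        traceMoment (entryMoment P (X n)) z) / Real.sqrt n ^ (u.length + z.length + 4) := by
    rw [meanTrace₂, meanTrace, meanTrace, div_mul_div_comm, ← pow_add, sub_div]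
    congr 3
    ring
  rw [e, abs_div, abs_of_pos (pow_pos hs _), div_le_iff₀ (pow_pos hs _)]
  refine key.trans (le_of_eq ?_)
  rw [show u.length + z.length + 4 = (u.length + z.length + 1) + 3 by ring, pow_add _ _ 3]
  field_simp
  ring

theorem exists_abs_meanTrace_cons_sub_le (h : ∀ n, IsWignerFamily P (X n) K κ)
    (w : List (Fin m)) (j : Fin m) :
    ∃ C : ℝ, ∀ n : ℕ, 1 ≤ n →
      |meanTrace P X (j :: w) n -
        splitSum w fun u i z => if i = j then meanTrace₂ P X u z n else 0| ≤
        C * (Real.sqrt n)⁻¹ := by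
  obtain ⟨C, hC⟩ := IsEdgeMoment.abs_traceMoment_cons_sub_le (momentBound K κ) w
  refine ⟨C, fun n hn => ?_⟩
  have : Nonempty (Fin n) := ⟨⟨0, hn⟩⟩
  have key := hC (h n).isEdgeMoment j
  rw [Fintype.card_fin] at key
  have hs : 0 < Real.sqrt n := Real.sqrt_pos.2 (by exact_mod_cast hn)
  have e : (splitSum w fun u i z => if i = j then meanTrace₂ P X u z n else 0) =
      (Real.sqrt n ^ (w.length + 3))⁻¹ * splitSum w fun u i z =>
        if i = j then traceMoment₂ (entryMoment P (X n)) u z else 0 := by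
    rw [splitSum_mul_left]
    refine splitSum_congr fun u i z hw => ?_
    have hl : u.length + z.length + 4 = w.length + 3 := by rw [hw]; simp; ring
    rw [meanTrace₂, hl]
    split_ifs
    · rw [div_eq_inv_mul]
    · rw [mul_zero]
  rw [e, meanTrace, List.length_cons, div_eq_inv_mul, show w.length + 1 + 2 = w.length + 3 by ring,
    ← mul_sub, abs_mul, abs_of_pos (inv_pos.2 (pow_pos hs _)), inv_mul_le_iff₀ (pow_pos hs _)]
  refine key.trans (le_of_eq ?_)
  rw [pow_succ _ (w.length + 2)]
  field_simp

theorem tendsto_inv_sqrt_nat : Tendsto (fun n : ℕ => (Real.sqrt n)⁻¹) atTop (𝓝 0) :=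
  tendsto_inv_atTop_zero.comp (Real.tendsto_sqrt_atTop.comp tendsto_natCast_atTop_atTop)

theorem tendsto_meanTrace₂ (h : ∀ n, IsWignerFamily P (X n) K κ) {u z : List (Fin m)} {a b : ℝ}
    (hu : Tendsto (meanTrace P X u) atTop (𝓝 a)) (hz : Tendsto (meanTrace P X z) atTop (𝓝 b)) :
    Tendsto (meanTrace₂ P X u z) atTop (𝓝 (a * b)) := by
  obtain ⟨C, hC⟩ := exists_abs_meanTrace₂_sub_le h u z
  have h0 : Tendsto (fun n => meanTrace₂ P X u z n - meanTrace P X u n * meanTrace P X z n) atTop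
      (𝓝 0) := by
    refine squeeze_zero_norm' (a := fun n : ℕ => C * (Real.sqrt n ^ 3)⁻¹)
      (eventually_atTop.2 ⟨1, hC⟩) ?_
    have := (tendsto_inv_sqrt_nat.pow 3).const_mul C
    simpa using this
  have := h0.add (hu.mul hz)
  simpa using this

/-- Induction on the length: the Schwinger-Dyson equation reduces to two shorter words, and
decorrelation turns the mean of the product of their traces into the product of the means. -/
theorem tendsto_meanTrace (h : ∀ n, IsWignerFamily P (X n) K κ) : ∀ w : List (Fin m),
    Tendsto (meanTrace P X w) atTop (𝓝 (fockCoeff w []))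
  | [] => by
    refine tendsto_const_nhds.congr' (eventually_atTop.2 ⟨1, fun n hn => ?_⟩)
    have hn' : (n : ℝ) ≠ 0 := by positivity
    simp [meanTrace, traceMoment, sum_walks_nil, mixedMoment_nil (h n).isEdgeMoment.zero,
      fockCoeff, hn']
  | j :: w => by
    obtain ⟨C, hC⟩ := exists_abs_meanTrace_cons_sub_le h w j
    have h0 : Tendsto (fun n => meanTrace P X (j :: w) n -
        splitSum w fun u i z => if i = j then meanTrace₂ P X u z n else 0) atTop (𝓝 0) := by
      refine squeeze_zero_norm' (a := fun n : ℕ => C * (Real.sqrt n)⁻¹)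
        (eventually_atTop.2 ⟨1, hC⟩) ?_
      simpa using tendsto_inv_sqrt_nat.const_mul C
    have h1 : Tendsto (fun n => splitSum w fun u i z =>
        if i = j then meanTrace₂ P X u z n else 0) atTop (𝓝 (fockCoeff (j :: w) [])) := by
      rw [fockCoeff_cons_nil]
      refine tendsto_splitSum fun u i z hw => ?_
      have hlu : u.length < (j :: w).length := by rw [hw]; simp
      have hlz : z.length < (j :: w).length := by rw [hw]; simp; omega
      split_ifs
      · exact tendsto_meanTrace₂ h (tendsto_meanTrace h u) (tendsto_meanTrace h z)
      · exact tendsto_const_nhds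
    have := h0.add h1
    simpa using this
termination_by w => w.length

theorem summable_inv_sqrt_pow_three : Summable fun n : ℕ => (Real.sqrt n ^ 3)⁻¹ := by
  have := Real.summable_nat_rpow_inv (p := 3 / 2) |>.2 (by norm_num)
  refine this.congr fun n => ?_
  rw [Real.sqrt_eq_rpow, ← Real.rpow_mul_natCast (Nat.cast_nonneg n)]
  norm_num

theorem ae_tendsto_normTrace (h : ∀ n, IsWignerFamily P (X n) K κ) (w : List (Fin m)) :
    ∀ᵐ ω ∂P, Tendsto (fun n => normTrace X w n ω) atTop (𝓝 (fockCoeff w [])) := by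
  obtain ⟨C, hC⟩ := exists_abs_meanTrace₂_sub_le h w w
  have hmem : ∀ n, MemLp (normTrace X w n) 2 P := fun n => by
    have := ((h n).memLp_wordTrace w 2).mul_const (Real.sqrt n ^ (w.length + 2))⁻¹
    simpa [normTrace, div_eq_mul_inv] using! this
  have hmean : ∀ n, ∫ ω, normTrace X w n ω ∂P = meanTrace P X w n := fun n => by
    simp only [normTrace, meanTrace, integral_div, (h n).integral_wordTrace]
  have hsq : ∀ n, ∫ ω, normTrace X w n ω ^ 2 ∂P = meanTrace₂ P X w w n := fun n => by
    rw [meanTrace₂, ← (h n).integral_wordTrace_mul, ← integral_div]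
    refine integral_congr_ae (Eventually.of_forall fun ω => ?_)
    simp only [normTrace]
    rw [div_pow, ← pow_mul, sq]
    congr 2
    ring
  have hint : ∀ n, Integrable (normTrace X w n) P := fun n => (hmem n).integrable (by norm_num)
  have hvar : ∀ n, ∫ ω, (normTrace X w n ω - meanTrace P X w n) ^ 2 ∂P =
      meanTrace₂ P X w w n - meanTrace P X w n * meanTrace P X w n := fun n => by
    have e : ∀ ω, (normTrace X w n ω - meanTrace P X w n) ^ 2 =
        normTrace X w n ω ^ 2 - 2 * meanTrace P X w n * normTrace X w n ω +
          meanTrace P X w n ^ 2 := fun ω => by ring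
    simp only [e]
    have i1 : Integrable (fun ω => normTrace X w n ω ^ 2) P := (hmem n).integrable_sq
    have i2 : Integrable (fun ω => 2 * meanTrace P X w n * normTrace X w n ω) P :=
      (hint n).const_mul _
    have i3 : Integrable (fun ω => normTrace X w n ω ^ 2 -
      2 * meanTrace P X w n * normTrace X w n ω) P := i1.sub i2
    rw [integral_add i3 (integrable_const _), integral_sub i1 i2, integral_const_mul, hsq, hmean]
    simp
    ring
  -- The variance is `O(n^(-3/2))`, which is summable; the index is shifted because the bound holds
  -- for `n ≥ 1` only.
  have hfin : ∀ᵐ ω ∂P, Tendsto (fun n => (normTrace X w (n + 1) ω - meanTrace P X w (n + 1)) ^ 2)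
      atTop (𝓝 0) := by
    refine ae_tendsto_zero_of_summable_integral (b := fun n => C * (Real.sqrt (n + 1 : ℕ) ^ 3)⁻¹)
      (fun n ω => sq_nonneg _) (fun n => ((hmem _).sub (memLp_const _)).integrable_sq)
      (fun n => ?_) ?_
    · rw [hvar]
      exact (le_abs_self _).trans (hC _ (by omega))
    · exact ((summable_nat_add_iff 1).2 summable_inv_sqrt_pow_three).mul_left C
  filter_upwards [hfin] with ω hω
  have h1 : Tendsto (fun n => (normTrace X w n ω - meanTrace P X w n) ^ 2) atTop (𝓝 0) :=
    (tendsto_add_atTop_iff_nat 1).1 hω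
  have h2 : Tendsto (fun n => normTrace X w n ω - meanTrace P X w n) atTop (𝓝 0) := by
    have := h1.sqrt
    simp only [Real.sqrt_sq_eq_abs, Real.sqrt_zero] at this
    exact (tendsto_zero_iff_abs_tendsto_zero _).2 this
  have := h2.add (tendsto_meanTrace h w)
  simpa using this

end Limit

/-! ### Removing the diagonal -/

section NormedRing

variable {R ι : Type*} [NormedRing R]

theorem norm_list_prod_map_le_pow (h1 : ‖(1 : R)‖ ≤ 1) {f : ι → R} {y : ℝ} (hf : ∀ i, ‖f i‖ ≤ y)
    (w : List ι) : ‖(w.map f).prod‖ ≤ y ^ w.length := by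
  induction w with
  | nil => simpa using h1
  | cons i w ih =>
    rw [List.map_cons, List.prod_cons, List.length_cons, pow_succ']
    exact (norm_mul_le _ _).trans
      (mul_le_mul (hf i) ih (norm_nonneg _) ((norm_nonneg _).trans (hf i)))

/-- Telescoping, one factor at a time. Only `‖1‖ ≤ 1` is assumed, so that matrices of size zero are
included. -/
theorem norm_list_prod_map_add_sub_le (h1 : ‖(1 : R)‖ ≤ 1) {f e : ι → R} {y δ : ℝ} (hy : 1 ≤ y)
    (hf : ∀ i, ‖f i‖ ≤ y) (hfe : ∀ i, ‖f i + e i‖ ≤ y) (he : ∀ i, ‖e i‖ ≤ δ) (hδ : 0 ≤ δ)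
    (w : List ι) :
    ‖(w.map fun i => f i + e i).prod - (w.map f).prod‖ ≤ w.length * δ * y ^ w.length := by
  induction w with
  | nil => simp
  | cons i w ih =>
    simp only [List.map_cons, List.prod_cons, List.length_cons]
    have hy0 : 0 ≤ y := zero_le_one.trans hy
    calc ‖(f i + e i) * (w.map fun i => f i + e i).prod - f i * (w.map f).prod‖
        = ‖(f i + e i) * ((w.map fun i => f i + e i).prod - (w.map f).prod) +
            e i * (w.map f).prod‖ := by congr 1; noncomm_ring
      _ ≤ y * (w.length * δ * y ^ w.length) + δ * y ^ w.length := by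
        refine (norm_add_le _ _).trans (add_le_add ((norm_mul_le _ _).trans ?_)
          ((norm_mul_le _ _).trans ?_))
        · exact mul_le_mul (hfe i) ih (norm_nonneg _) hy0
        · exact mul_le_mul (he i) (norm_list_prod_map_le_pow h1 hf w) (norm_nonneg _) hδ
      _ ≤ y * (w.length * δ * y ^ w.length) + δ * y ^ (w.length + 1) := by
        gcongr
        omega
      _ = _ := by push_cast; ring

end NormedRing

/-! ### Operator norm and traces of powers -/

section OperatorNorm

open scoped Matrix.Norms.L2Operator
open Matrix

variable {n : ℕ}

theorem l2_opNorm_one_le : ‖(1 : Matrix (Fin n) (Fin n) ℝ)‖ ≤ 1 := by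
  rw [← Matrix.diagonal_one, Matrix.l2_opNorm_diagonal]
  exact (pi_norm_le_iff_of_nonneg zero_le_one).2 fun i => by simp

theorem abs_trace_le_l2_opNorm (A : Matrix (Fin n) (Fin n) ℝ) : |A.trace| ≤ n * ‖A‖ := by
  have h : ∀ i, |A i i| ≤ ‖A‖ := fun i => by
    have h1 := A.l2_opNorm_mulVec (PiLp.single 2 i 1)
    rw [PiLp.norm_single, norm_one, mul_one] at h1
    refine le_trans ?_ h1
    refine le_trans (le_of_eq ?_) (PiLp.norm_apply_le _ i)
    simp
  calc |A.trace| ≤ ∑ i, |A i i| := Finset.abs_sum_le_sum_abs _ _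
    _ ≤ ∑ _i : Fin n, ‖A‖ := Finset.sum_le_sum fun i _ => h i
    _ = n * ‖A‖ := by simp

theorem sq_l2_opNorm_le_trace {A : Matrix (Fin n) (Fin n) ℝ} (hA : A.IsSymm) :
    ‖A‖ ^ 2 ≤ (A * A).trace := by
  have htr : (A * A).trace = ∑ i, ∑ j, A i j ^ 2 := by
    simp only [Matrix.trace, Matrix.diag_apply, Matrix.mul_apply]
    refine Finset.sum_congr rfl fun i _ => Finset.sum_congr rfl fun j _ => ?_
    rw [hA.apply i j, sq]
  have h0 : 0 ≤ ∑ i, ∑ j, A i j ^ 2 := by positivity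
  rw [htr]
  refine (Real.le_sqrt (norm_nonneg _) h0).1 ?_
  rw [Matrix.l2_opNorm_def]
  refine ContinuousLinearMap.opNorm_le_bound _ (Real.sqrt_nonneg _) fun x => ?_
  refine abs_le_of_sq_le_sq' ?_ (by positivity) |>.2
  rw [mul_pow, Real.sq_sqrt h0, EuclideanSpace.real_norm_sq_eq, EuclideanSpace.real_norm_sq_eq,
    Finset.sum_mul]
  refine Finset.sum_le_sum fun i _ => ?_
  refine le_trans (le_of_eq ?_) (Finset.sum_mul_sq_le_sq_mul_sq Finset.univ (A i) x)
  congr 1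

/-- The squared operator norm of `A ^ 2 ^ p` is at most its squared Hilbert-Schmidt norm, and for
self-adjoint `A` the C*-identity gives `‖A ^ 2 ^ p‖ = ‖A‖ ^ 2 ^ p`. -/
theorem l2_opNorm_pow_le_trace {A : Matrix (Fin n) (Fin n) ℝ} (hA : A.IsSymm) (p : ℕ) :
    ‖A‖ ^ 2 ^ (p + 1) ≤ (A ^ 2 ^ (p + 1)).trace := by
  have hsa : IsSelfAdjoint A := by
    rw [IsSelfAdjoint, Matrix.star_eq_conjTranspose, Matrix.conjTranspose_eq_transpose_of_trivial]
    exact hA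
  have h := sq_l2_opNorm_le_trace (hA.pow (2 ^ p))
  rwa [hsa.norm_pow_two_pow, ← pow_mul, ← pow_add, ← mul_two, ← pow_succ] at h

end OperatorNorm

/-! ### Splitting off the diagonal -/

section Diagonal

variable {Ω : Type*} {m : ℕ} (X : (n : ℕ) → Fin m → Ω → Matrix (Fin n) (Fin n) ℂ)

/-- The normalized off-diagonal parts of the random matrices. -/
noncomputable def offDiagPart (n : ℕ) (ω : Ω) (j : Fin m) : Matrix (Fin n) (Fin n) ℝ :=
  (Real.sqrt n)⁻¹ • edgeMatrix (fun c => entryVar (X n) c ω) j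

/-- The normalized diagonal parts of the random matrices. -/
noncomputable def diagPart (n : ℕ) (ω : Ω) (j : Fin m) : Matrix (Fin n) (Fin n) ℝ :=
  (Real.sqrt n)⁻¹ • Matrix.diagonal fun i => (X n j ω i i).re

variable {X}

theorem offDiagPart_isSymm (n : ℕ) (ω : Ω) (j : Fin m) : (offDiagPart X n ω j).IsSymm := by
  ext i k
  simp [offDiagPart, edgeMatrix, Sym2.eq_swap]

theorem prod_map_smul {ι R A : Type*} [CommSemiring R] [Semiring A] [Algebra R A] (c : R)
    (f : ι → A) (w : List ι) :
    (w.map fun i => c • f i).prod = c ^ w.length • (w.map f).prod := by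
  induction w with
  | nil => simp
  | cons i w ih =>
    rw [List.map_cons, List.prod_cons, ih, List.map_cons, List.prod_cons, smul_mul_smul_comm,
      List.length_cons, pow_succ']

theorem trace_prod_offDiagPart {n : ℕ} (hn : 1 ≤ n) (ω : Ω) (w : List (Fin m)) :
    (w.map (offDiagPart X n ω)).prod.trace = n * normTrace X w n ω := by
  have hs : (Real.sqrt n) ≠ 0 := (Real.sqrt_pos.2 (by exact_mod_cast hn)).ne'
  have hn0 : (n : ℝ) ≠ 0 := by positivity
  have e : (w.map (offDiagPart X n ω)).prod = (Real.sqrt n)⁻¹ ^ w.length •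
      (w.map (edgeMatrix fun c => entryVar (X n) c ω)).prod := by
    unfold offDiagPart
    exact prod_map_smul _ _ _
  rw [e, Matrix.trace_smul, smul_eq_mul, normTrace, wordTrace, inv_pow]
  rw [pow_add, Real.sq_sqrt (Nat.cast_nonneg n)]
  field_simp

open scoped Matrix.Norms.L2Operator

theorem eventually_norm_offDiagPart_le {ω : Ω} {j : Fin m} {N : ℕ} {c : ℝ}
    (h : Tendsto (fun n => normTrace X (List.replicate (2 ^ (N + 1)) j) n ω) atTop (𝓝 c)) :
    ∀ᶠ n : ℕ in atTop, ‖offDiagPart X n ω j‖ ^ 2 ^ (N + 1) ≤ (c + 1) * n := by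
  filter_upwards [h.eventually_le_const (lt_add_one c), eventually_ge_atTop 1] with n h1 hn
  refine (l2_opNorm_pow_le_trace (offDiagPart_isSymm n ω j) N).trans ?_
  have := trace_prod_offDiagPart (X := X) hn ω (List.replicate (2 ^ (N + 1)) j)
  rw [List.map_replicate, List.prod_replicate] at this
  rw [this, mul_comm]
  gcongr

/-- Eventually the twelfth powers of the diagonal entries sum to at most `n³`, so each entry is at
most `n^(3/12) = n^(1/4)`; normalization divides by `n^(1/2)`. -/
theorem eventually_norm_diagPart_le {ω : Ω} {j : Fin m}
    (h : Tendsto (fun n : ℕ => (∑ i, |(X n j ω i i).re| ^ 12) / (n : ℝ) ^ 3) atTop (𝓝 0)) :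
    ∀ᶠ n : ℕ in atTop, ‖diagPart X n ω j‖ ≤ (n : ℝ) ^ (-(1 / 4) : ℝ) := by
  filter_upwards [h.eventually_le_const zero_lt_one, eventually_ge_atTop 1] with n h1 hn
  have hn0 : (0 : ℝ) < n := by exact_mod_cast hn
  rw [div_le_one (by positivity)] at h1
  have h2 : ∀ i, |(X n j ω i i).re| ≤ (n : ℝ) ^ (1 / 4 : ℝ) := fun i => by
    refine le_of_pow_le_pow_left₀ (n := 12) (by norm_num) (by positivity) ?_
    rw [← Real.rpow_mul_natCast hn0.le]
    refine ((Finset.single_le_sum (f := fun i => |(X n j ω i i).re| ^ 12)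
      (fun _ _ => by positivity) (Finset.mem_univ i)).trans h1).trans (le_of_eq ?_)
    rw [← Real.rpow_natCast]
    norm_num
  rw [diagPart, norm_smul, Matrix.l2_opNorm_diagonal, norm_inv,
    Real.norm_of_nonneg (Real.sqrt_nonneg _)]
  calc (Real.sqrt n)⁻¹ * ‖fun i => (X n j ω i i).re‖ ≤ (Real.sqrt n)⁻¹ * (n : ℝ) ^ (1 / 4 : ℝ) := by
        gcongr
        exact (pi_norm_le_iff_of_nonneg (by positivity)).2 h2
    _ = _ := by
        rw [Real.sqrt_eq_rpow, ← Real.rpow_neg hn0.le, ← Real.rpow_add hn0]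
        norm_num

theorem tendsto_trace_prod_sub {ω : Ω}
    (hY : ∀ w, Tendsto (fun n => normTrace X w n ω) atTop (𝓝 (fockCoeff w [])))
    (hD : ∀ j, Tendsto (fun n : ℕ => (∑ i, |(X n j ω i i).re| ^ 12) / (n : ℝ) ^ 3) atTop (𝓝 0))
    (w : List (Fin m)) :
    Tendsto (fun n : ℕ => (n : ℝ)⁻¹ *
      (w.map fun j => offDiagPart X n ω j + diagPart X n ω j).prod.trace) atTop
      (𝓝 (fockCoeff w [])) := by
  set k := w.length with hk
  -- The power is taken so high that `k` factors of norm at most `(C n)^(1/N)` cost at most `(C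
  -- n)^(1/8)`, half the exponent gained from one diagonal factor `n^(-1/4)`.
  set N : ℕ := 2 ^ (3 + k + 1) with hN
  have hNk : 8 * k ≤ N := by
    have : k < 2 ^ k := Nat.lt_two_pow_self
    rw [hN, pow_succ, pow_add]
    omega
  have hN0 : N ≠ 0 := by positivity
  obtain ⟨C, hC1, hC⟩ : ∃ C : ℝ, 1 ≤ C ∧ ∀ j : Fin m, fockCoeff (List.replicate N j) [] + 1 ≤ C := by
    refine ⟨1 + ∑ j : Fin m, |fockCoeff (List.replicate N j) [] + 1|, ?_, fun j => ?_⟩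
    · have : 0 ≤ ∑ j : Fin m, |fockCoeff (List.replicate N j) [] + 1| := by positivity
      linarith
    · have := Finset.single_le_sum (f := fun j : Fin m => |fockCoeff (List.replicate N j) [] + 1|)
        (fun _ _ => abs_nonneg _) (Finset.mem_univ j)
      have := le_abs_self (fockCoeff (List.replicate N j) [] + 1)
      linarith
  have h1 : ∀ᶠ n : ℕ in atTop, ∀ j, ‖offDiagPart X n ω j‖ ^ N ≤ C * n := by
    refine eventually_all.2 fun j => ?_
    filter_upwards [eventually_norm_offDiagPart_le (N := 3 + k) (hY (List.replicate N j))]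
      with n hn
    exact hn.trans (by gcongr; exact hC j)
  have h2 : ∀ᶠ n : ℕ in atTop, ∀ j, ‖diagPart X n ω j‖ ≤ (n : ℝ) ^ (-(1 / 4) : ℝ) :=
    eventually_all.2 fun j => eventually_norm_diagPart_le (hD j)
  have h3 : Tendsto (fun n : ℕ => (n : ℝ)⁻¹ *
      (w.map fun j => offDiagPart X n ω j + diagPart X n ω j).prod.trace - normTrace X w n ω)
      atTop (𝓝 0) := by
    refine squeeze_zero_norm' (a := fun n : ℕ =>
      k * 3 ^ k * C ^ (1 / 8 : ℝ) * (n : ℝ) ^ (-(1 / 8) : ℝ)) ?_ ?_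
    · filter_upwards [h1, h2, eventually_ge_atTop 1] with n hn1 hn2 hn
      have hnr : (1 : ℝ) ≤ n := by exact_mod_cast hn
      have hn0 : (0 : ℝ) < n := by linarith
      have hCn : 1 ≤ C * n := one_le_mul_of_one_le_of_one_le hC1 hnr
      set t : ℝ := (C * n) ^ ((N : ℝ)⁻¹) with ht
      have ht1 : 1 ≤ t := Real.one_le_rpow hCn (by positivity)
      have htN : t ^ N = C * n := Real.rpow_inv_natCast_pow (by positivity) hN0
      have hYt : ∀ j, ‖offDiagPart X n ω j‖ ≤ t := fun j =>
        le_of_pow_le_pow_left₀ hN0 (by positivity) ((hn1 j).trans htN.ge)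
      have hD1 : (n : ℝ) ^ (-(1 / 4) : ℝ) ≤ 1 :=
        Real.rpow_le_one_of_one_le_of_nonpos hnr (by norm_num)
      -- The value `3 * t` bounds both the off-diagonal part and the full matrix, since the diagonal
      -- part has norm at most `1 ≤ t`.
      have hdiff := norm_list_prod_map_add_sub_le l2_opNorm_one_le (f := offDiagPart X n ω)
        (e := diagPart X n ω) (y := 3 * t) (δ := (n : ℝ) ^ (-(1 / 4) : ℝ)) (by linarith)
        (fun j => (hYt j).trans (by linarith))
        (fun j => (norm_add_le _ _).trans (by linarith [hYt j, hn2 j])) hn2 (by positivity) w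
      have htk : t ^ k ≤ C ^ (1 / 8 : ℝ) * (n : ℝ) ^ (1 / 8 : ℝ) := by
        rw [← Real.mul_rpow (by linarith) hn0.le, ht, ← Real.rpow_mul_natCast (by positivity)]
        refine Real.rpow_le_rpow_of_exponent_le hCn ?_
        rw [inv_mul_le_iff₀ (by positivity)]
        have : (8 * k : ℝ) ≤ N := by exact_mod_cast hNk
        linarith
      have hnorm : (normTrace X w n ω) = (n : ℝ)⁻¹ * (w.map (offDiagPart X n ω)).prod.trace := by
        rw [trace_prod_offDiagPart hn, inv_mul_cancel_left₀ hn0.ne']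
      rw [hnorm, ← mul_sub, ← Matrix.trace_sub, norm_mul, norm_inv, Real.norm_natCast,
        inv_mul_le_iff₀ hn0]
      refine (abs_trace_le_l2_opNorm _).trans ?_
      refine mul_le_mul_of_nonneg_left (hdiff.trans ?_) hn0.le
      rw [← hk, mul_pow]
      calc k * (n : ℝ) ^ (-(1 / 4) : ℝ) * (3 ^ k * t ^ k)
          ≤ k * (n : ℝ) ^ (-(1 / 4) : ℝ) * (3 ^ k * (C ^ (1 / 8 : ℝ) * (n : ℝ) ^ (1 / 8 : ℝ))) := by
            gcongr
        _ = k * 3 ^ k * C ^ (1 / 8 : ℝ) * ((n : ℝ) ^ (-(1 / 4) : ℝ) * (n : ℝ) ^ (1 / 8 : ℝ)) := by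
            ring
        _ = _ := by rw [← Real.rpow_add hn0]; norm_num
    · have := ((tendsto_rpow_neg_atTop (y := 1 / 8) (by norm_num)).comp
        (tendsto_natCast_atTop_atTop (R := ℝ))).const_mul (k * 3 ^ k * C ^ (1 / 8 : ℝ))
      simpa using! this
  simpa using h3.add (hY w)

end Diagonal

/-! ### Almost sure smallness of the diagonal -/

section Summation

variable {Ω : Type*} [MeasurableSpace Ω] {P : Measure Ω} [IsProbabilityMeasure P] {m : ℕ}
  {X : (n : ℕ) → Fin m → Ω → Matrix (Fin n) (Fin n) ℂ} {K κ : ℝ}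

/-- Uniformly bounded twelfth moments give expectation `O(n / n³)`, which is summable; nothing about
the joint law of the diagonal entries enters. -/
theorem ae_tendsto_sum_diag (h : ∀ n, IsWignerFamily P (X n) K κ) (j : Fin m) :
    ∀ᵐ ω ∂P, Tendsto (fun n : ℕ => (∑ i, |(X n j ω i i).re| ^ 12) / (n : ℝ) ^ 3) atTop (𝓝 0) := by
  refine ae_tendsto_zero_of_summable_integral (b := fun n : ℕ => momentBound K κ 12 *
    ((n : ℝ) ^ 2)⁻¹) (fun n ω => by positivity)
    (fun n => (integrable_finsetSum _ fun i _ => ((h n).moments_re j i i 12).1).div_const _)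
    (fun n => ?_) ((Real.summable_nat_pow_inv.2 (by norm_num)).mul_left _)
  rw [integral_div, integral_finsetSum _ fun i _ => ((h n).moments_re j i i 12).1]
  have h1 : ∑ i, ∫ ω, |(X n j ω i i).re| ^ 12 ∂P ≤ n * momentBound K κ 12 := by
    refine (Finset.sum_le_card_nsmul _ _ _ fun i _ => ((h n).moments_re j i i 12).2).trans ?_
    simp
  rcases Nat.eq_zero_or_pos n with rfl | hn
  · simp
  · have hn0 : (0 : ℝ) < n := by exact_mod_cast hn
    rw [div_le_iff₀ (by positivity)]
    refine h1.trans (le_of_eq ?_)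
    field_simp

end Summation

/-! ### Words and polynomials -/

section Eval

theorem StarPoly.induction_words {m : ℕ} {S : Submodule ℂ (StarPoly m)}
    (h : ∀ v : List (Fin m ⊕ Fin m), (v.map (FreeAlgebra.ι ℂ)).prod ∈ S) (Q : StarPoly m) :
    Q ∈ S := by
  have hQ : Q ∈ Algebra.adjoin ℂ (Set.range (FreeAlgebra.ι ℂ : Fin m ⊕ Fin m → StarPoly m)) := by
    rw [FreeAlgebra.adjoin_range_ι]; trivial
  rw [← Subalgebra.mem_toSubmodule, Algebra.adjoin_eq_span] at hQ
  refine Submodule.span_le.2 (fun x hx => ?_) hQ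
  obtain ⟨v, rfl⟩ : ∃ v : List (Fin m ⊕ Fin m), (v.map (FreeAlgebra.ι ℂ)).prod = x := by
    refine Submonoid.closure_induction (motive := fun x _ => ∃ v : List (Fin m ⊕ Fin m),
      (v.map (FreeAlgebra.ι ℂ)).prod = x) ?_ ⟨[], rfl⟩ ?_ hx
    · rintro _ ⟨i, rfl⟩
      exact ⟨[i], by simp⟩
    · rintro _ _ _ _ ⟨v, rfl⟩ ⟨v', rfl⟩
      exact ⟨v ++ v', by simp⟩
  exact h v

theorem StarPoly.eval_word {m : ℕ} {A : Type*} [Ring A] [StarRing A] [Algebra ℂ A] {a : Fin m → A}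
    (ha : ∀ j, IsSelfAdjoint (a j)) (v : List (Fin m ⊕ Fin m)) :
    StarPoly.eval a (v.map (FreeAlgebra.ι ℂ)).prod =
      ((v.map (Sum.elim id id)).map a).prod := by
  rw [StarPoly.eval, map_list_prod, List.map_map, List.map_map]
  congr 1
  refine List.map_congr_left fun i _ => ?_
  rcases i with j | j
  · simp
  · simpa using (ha j).star_eq

end Eval

/-! ### From real matrices to the complex trace statistic -/

section Complexification

variable {Ω : Type*} {m : ℕ} {X : (n : ℕ) → Fin m → Ω → Matrix (Fin n) (Fin n) ℂ}

theorem smul_eq_map_parts {n : ℕ} {ω : Ω} (hre : ∀ j i k, (X n j ω i k).im = 0)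
    (hsym : ∀ j, (X n j ω).IsSymm) (j : Fin m) :
    ((Real.sqrt n : ℂ))⁻¹ • X n j ω =
      Complex.ofRealHom.mapMatrix (offDiagPart X n ω j + diagPart X n ω j) := by
  ext i k
  have hX : X n j ω i k = (((X n j ω i k).re : ℝ) : ℂ) := Complex.ext rfl (by simp [hre])
  have hk : edgeMatrix (fun c => entryVar (X n) c ω) j i k +
      Matrix.diagonal (fun i => (X n j ω i i).re) i k = (X n j ω i k).re := by
    rw [edgeMatrix, Matrix.of_apply, entryVar]
    by_cases hik : i = k
    · subst hik
      simp
    · rw [if_neg (by simpa using hik), Matrix.diagonal_apply_ne _ hik, add_zero]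
      rcases le_total i k with h | h
      · simp [h]
      · simp [h, (hsym j).apply i k]
  rw [offDiagPart, diagPart, ← smul_add, RingHom.mapMatrix_apply, Matrix.map_apply,
    Matrix.smul_apply, Matrix.smul_apply, Matrix.add_apply, hk, hX]
  simp

theorem inv_mul_traceStat_word {n : ℕ} {ω : Ω} (hre : ∀ j i k, (X n j ω i k).im = 0)
    (hsym : ∀ j, (X n j ω).IsSymm) (v : List (Fin m ⊕ Fin m)) :
    (n : ℂ)⁻¹ * traceStat (v.map (FreeAlgebra.ι ℂ)).prod (fun j => X n j ω) =
      (((n : ℝ)⁻¹ * ((v.map (Sum.elim id id)).map fun j =>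
        offDiagPart X n ω j + diagPart X n ω j).prod.trace : ℝ) : ℂ) := by
  have hsa : ∀ j, IsSelfAdjoint (((Real.sqrt n : ℂ))⁻¹ • X n j ω) := fun j => by
    rw [smul_eq_map_parts hre hsym, IsSelfAdjoint, Matrix.star_eq_conjTranspose]
    have : (offDiagPart X n ω j + diagPart X n ω j).IsSymm :=
      (offDiagPart_isSymm n ω j).add ((Matrix.isSymm_diagonal _).smul _)
    ext i k
    rw [Matrix.conjTranspose_apply, RingHom.mapMatrix_apply, Matrix.map_apply, Matrix.map_apply,
      this.apply]
    simp
  rw [traceStat, StarPoly.eval_word hsa, funext (smul_eq_map_parts hre hsym)]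
  have e : ((v.map (Sum.elim id id)).map fun j => Complex.ofRealHom.mapMatrix
      (offDiagPart X n ω j + diagPart X n ω j)).prod =
      Complex.ofRealHom.mapMatrix ((v.map (Sum.elim id id)).map fun j =>
        offDiagPart X n ω j + diagPart X n ω j).prod := by
    rw [map_list_prod]; simp only [List.map_map]; rfl
  rw [e]
  simp [Matrix.trace]

theorem traceStat_add {n : ℕ} (Q R : StarPoly m) (A : Fin m → Matrix (Fin n) (Fin n) ℂ) :
    traceStat (Q + R) A = traceStat Q A + traceStat R A := by
  simp [traceStat, StarPoly.eval]

theorem traceStat_smul {n : ℕ} (c : ℂ) (Q : StarPoly m) (A : Fin m → Matrix (Fin n) (Fin n) ℂ) :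
    traceStat (c • Q) A = c * traceStat Q A := by
  simp [traceStat, StarPoly.eval]

end Complexification

end NCProb

/-- For every `n`, `X n 1, …, X n m` are independent centered random `n × n` matrices with the convex
concentration property (with constants independent of `n`), real symmetric, with independent
entries of unit variance above the diagonal. -/
theorem corollary3 {Ω : Type*} [MeasurableSpace Ω] (P : Measure Ω) [IsProbabilityMeasure P]
    {m : ℕ} (X : (n : ℕ) → Fin m → Ω → Matrix (Fin n) (Fin n) ℂ)
    (hmeas : ∀ n j, ∀ i k, Measurable fun ω => X n j ω i k)
    (hindep : ∀ n, iIndepFun (β := fun _ => Fin n → Fin n → ℂ) (fun j ω i k => X n j ω i k) P)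
    (hcentered : ∀ n j, ∀ i k, ∫ ω, X n j ω i k ∂P = 0)
    (hccp : ∃ K κ : ℝ, 0 < K ∧ 0 < κ ∧
      ∀ n j, NCProb.MatrixConvexConcentration P (X n j) K κ)
    (hreal : ∀ n j, ∀ᵐ ω ∂P, ∀ i k, (X n j ω i k).im = 0)
    (hsymm : ∀ n j, ∀ᵐ ω ∂P, (X n j ω).IsSymm)
    (hentries : ∀ n j, iIndepFun
      (fun (e : {e : Fin n × Fin n // e.1 < e.2}) ω => X n j ω e.1.1 e.1.2) P)
    (hvar : ∀ n j, ∀ i k : Fin n, i < k → Var[fun ω => (X n j ω i k).re; P] = 1)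
    (Q : NCProb.StarPoly m)
    {A : Type*} [Ring A] [StarRing A] [Algebra ℂ A] [StarModule ℂ A]
    (τ : A →ₗ[ℂ] ℂ) (hτ : τ 1 = 1)
    (a : Fin m → A) (ha : NCProb.IsFreeSemicircularFamily τ a) :
    ∀ᵐ ω ∂P, Tendsto
      (fun n : ℕ => (n : ℂ)⁻¹ * NCProb.traceStat Q (fun j => X n j ω))
      atTop (𝓝 (τ (NCProb.StarPoly.eval a Q))) := by
  obtain ⟨K, κ, hK, hκ, hccp⟩ := hccp
  have hX : ∀ n, NCProb.IsWignerFamily P (X n) K κ := fun n =>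
    ⟨hmeas n, hindep n, hcentered n, hK, hκ, hccp n, hreal n, hsymm n, hentries n, hvar n⟩
  -- There are only countably many words, so one null set serves them all.
  have hwords : ∀ᵐ ω ∂P, ∀ w, Tendsto (fun n => NCProb.normTrace X w n ω) atTop
      (𝓝 (NCProb.fockCoeff w [])) := ae_all_iff.2 (NCProb.ae_tendsto_normTrace hX)
  have hdiag := ae_all_iff.2 (NCProb.ae_tendsto_sum_diag hX)
  have hre := ae_all_iff.2 fun n => ae_all_iff.2 (hreal n)
  have hsy := ae_all_iff.2 fun n => ae_all_iff.2 (hsymm n)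
  filter_upwards [hwords, hdiag, hre, hsy] with ω hω1 hω2 hω3 hω4
  -- For fixed `ω`, the polynomials for which convergence holds form a linear subspace; it contains
  -- all words and hence everything.
  let S : Submodule ℂ (NCProb.StarPoly m) :=
    { carrier := {Q | Tendsto (fun n : ℕ => (n : ℂ)⁻¹ * NCProb.traceStat Q (fun j => X n j ω))
        atTop (𝓝 (τ (NCProb.StarPoly.eval a Q)))}
      zero_mem' := by simp [NCProb.traceStat, NCProb.StarPoly.eval]
      add_mem' := fun {Q R} hQ hR => by
        have := Tendsto.add (show Tendsto _ _ _ from hQ) (show Tendsto _ _ _ from hR)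
        simpa [NCProb.traceStat_add, mul_add, NCProb.StarPoly.eval] using this
      smul_mem' := fun c Q hQ => by
        have := Tendsto.const_mul c (show Tendsto _ _ _ from hQ)
        simpa [NCProb.traceStat_smul, mul_left_comm, NCProb.StarPoly.eval] using this }
  refine NCProb.StarPoly.induction_words (S := S) (fun v => ?_) Q
  change Tendsto _ _ _
  rw [NCProb.StarPoly.eval_word fun j => (ha.1 j).1, ha.apply_prod hτ]
  refine Tendsto.congr (fun n => (NCProb.inv_mul_traceStat_word (hω3 n) (hω4 n) v).symm) ?_
  exact (Complex.continuous_ofReal.tendsto _).comp (NCProb.tendsto_trace_prod_sub hω1 hω2 _)
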